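/- Let $n\ge 2$ and let $\Gamma$ be a $C^\infty$ closed planar curve with everywhere positive curvature (an oval), invariant under the rotation of angle $2\pi/n$ about the origin and parametrized counterclockwise by the angle $\phi$ of its oriented tangent. Let $g(\phi)$ be its support function with respect to the origin, let $s(\phi)$ be arc length along $\Gamma$, and let $|\Gamma|$ be its perimeter. Write the billiard map of $\Gamma$, lifted to $\mathbb R\times(-1,1)$, in the coordinates $(s,p)$ with $p=\cos\alpha$, where $\alpha\in(0,\pi)$ is the angle from the tangent to the outgoing trajectory. For $1\le m\le n-1$ let $T_m$ be the billiard map followed by $(s,p)\mapsto(s-\frac mn|\Gamma|,p)$, that is, by the rotation of angle $-2\pi m/n$. Suppose that $\phi_0$ carries a family of elliptic symmetric orbits, i.e. for every $1\le m\le n-1$ the point $P_m=(s(\phi_0),\cos\frac{m\pi}{n})$ is a fixed point of $T_m$ at which $DT_m$ has non-real eigenvalues of modulus $1$. Suppose that the family is non-resonant, i.e. $g''(\phi_0)\ne g(\phi_0)$ and $g''(\phi_0)\ne 3g(\phi_0)$. Then for every $m$ with $1\le m\le n/2$ the map $T_m$ has a well-defined first Birkhoff (twist) coefficient at $P_m$: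 there is exactly one $\tau_m\in\mathbb R$ such that, for some $\zeta\in\mathbb R$ and some $C^\infty$ complex coordinate $z=h(s,p)$ near $P_m$ with $h(P_m)=0$ and Jacobian determinant $1$ at $P_m$, $T_m$ takes the form $$z\mapsto e^{i(\zeta+\tau_m|z|^2)}z+O(|z|^4)\qquad (z\to 0).$$ Moreover $\tau_m=0$ for at most one value of $m$ with $1\le m\le n/2$. -/

import Mathlib

open scoped Topology ContDiff

noncomputable section

/-- A smooth (`C^∞`) oval with `n`-fold rotational symmetry about the origin of the plane `ℂ`,
parametrized by the angle `φ` of its oriented tangent (so the radius of curvature is `r > 0`).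
For `n ≥ 1` the last field makes `γ` periodic of period `2π`, hence a simple closed curve. -/
structure IsSymmetricOval (n : ℕ) (γ : ℝ → ℂ) : Prop where
  smooth : ContDiff ℝ ∞ γ
  tangent : ∀ φ : ℝ, ∃ r : ℝ, 0 < r ∧ deriv γ φ = (r : ℂ) * Complex.exp (Complex.I * φ)
  symmetric : ∀ φ : ℝ,
    γ (φ + 2 * Real.pi / n) = Complex.exp (Complex.I * (2 * Real.pi / n)) * γ φ

/-- The support function of the oval with respect to the origin, as a function of the tangent
angle: the inner product of the point with the outward unit normal `-i e^{iφ}`. -/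
def supportFunction (γ : ℝ → ℂ) (φ : ℝ) : ℝ :=
  inner ℝ (γ φ) (-Complex.I * Complex.exp (Complex.I * φ))

/-- Arc length along the curve, measured from the point with tangent angle `0`. -/
def arcLength (γ : ℝ → ℂ) (φ : ℝ) : ℝ :=
  ∫ t in (0 : ℝ)..φ, ‖deriv γ t‖

/-- One bounce of the billiard inside the oval, in canonical coordinates `(s, p)` lifted to the
universal cover: `s` is arc length and `p = cos α`, where `α ∈ (0, π)` is the angle from the oriented
tangent to the outgoing trajectory. The ball leaves the point of tangent angle `φ`, follows the
chord to the point of tangent angle `ψ`, and is reflected there with equal angles, so that the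
new outgoing angle is the angle between the chord and the tangent at the point of arrival. -/
def IsBilliardStep (γ : ℝ → ℂ) (x y : ℝ × ℝ) : Prop :=
  x.2 ∈ Set.Ioo (-1 : ℝ) 1 ∧
  ∃ φ ψ : ℝ, φ < ψ ∧ ψ < φ + 2 * Real.pi ∧
    x.1 = arcLength γ φ ∧ x.2 = Real.cos (InnerProductGeometry.angle (deriv γ φ) (γ ψ - γ φ)) ∧
    y.1 = arcLength γ ψ ∧ y.2 = Real.cos (InnerProductGeometry.angle (deriv γ ψ) (γ ψ - γ φ))

open Classical in
/-- The billiard map, lifted to the universal cover `ℝ × (-1, 1)` of the phase space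
(the identity outside of `ℝ × (-1, 1)`). -/
def billiardMap (γ : ℝ → ℂ) (x : ℝ × ℝ) : ℝ × ℝ :=
  if h : ∃ y, IsBilliardStep γ x y then h.choose else x

/-- The lift of the quotient (by the rotation of angle `2π/n`) of the billiard map which follows a
bounce by the rotation of angle `-2πm/n`, that is, by a translation of `-m/n` times the perimeter. -/
def quotientMap (γ : ℝ → ℂ) (n m : ℕ) (x : ℝ × ℝ) : ℝ × ℝ :=
  ((billiardMap γ x).1 - (m / n : ℝ) * arcLength γ (2 * Real.pi), (billiardMap γ x).2)

/-- The phase point with tangent angle `φ₀` and outgoing angle `mπ/n`. -/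
def symmetricPoint (γ : ℝ → ℂ) (n m : ℕ) (φ₀ : ℝ) : ℝ × ℝ :=
  (arcLength γ φ₀, Real.cos (m * Real.pi / n))

/-- `P` is an elliptic fixed point of the planar map `F`: the derivative has a non-real
eigenvalue on the unit circle (the other eigenvalue is then its conjugate). -/
def IsEllipticFixedPoint (F : ℝ × ℝ → ℝ × ℝ) (P : ℝ × ℝ) : Prop :=
  F P = P ∧ DifferentiableAt ℝ F P ∧
  ∃ z : ℂ, ‖z‖ = 1 ∧ z.im ≠ 0 ∧
    Polynomial.aeval z (LinearMap.charpoly (fderiv ℝ F P).toLinearMap) = 0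

/-- The tangent angle `φ₀` carries a family of elliptic symmetric orbits: for each
`1 ≤ m ≤ n - 1` the point `(φ₀, mπ/n)` is an elliptic fixed point of the quotient map. -/
def IsEllipticSymmetricFamily (γ : ℝ → ℂ) (n : ℕ) (φ₀ : ℝ) : Prop :=
  ∀ m : ℕ, 1 ≤ m → m < n →
    IsEllipticFixedPoint (quotientMap γ n m) (symmetricPoint γ n m φ₀)

/-- The family at `φ₀` is non-resonant: `g - g''` and `3g - g''` do not vanish at `φ₀`, where `g`
is the support function. -/
def IsNonResonantFamily (γ : ℝ → ℂ) (φ₀ : ℝ) : Prop :=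
  supportFunction γ φ₀ - iteratedDeriv 2 (supportFunction γ) φ₀ ≠ 0 ∧
  3 * supportFunction γ φ₀ - iteratedDeriv 2 (supportFunction γ) φ₀ ≠ 0

/-- `τ` is the first Birkhoff (twist) coefficient of the map `F` at its fixed point `P`: a `C^∞`
complex coordinate `z = h (s, p)` near `P`, centred at `P` and of Jacobian determinant `1` at `P`,
brings `F` into the form `z ↦ e^{i(ζ + τ|z|²)} z + O(|z|⁴)`. The Jacobian condition (which makes
`h` a local diffeomorphism) fixes the scale of `|z|` and the orientation, on which `τ` depends. -/
def IsTwistCoefficient (F : ℝ × ℝ → ℝ × ℝ) (P : ℝ × ℝ) (τ : ℝ) : Prop :=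
  F P = P ∧
  ∃ (h : ℝ × ℝ → ℂ) (ζ : ℝ),
    (∀ᶠ x in 𝓝 P, ContDiffAt ℝ ∞ h x) ∧ h P = 0 ∧
    ((starRingEnd ℂ) (fderiv ℝ h P (1, 0)) * fderiv ℝ h P (0, 1)).im = 1 ∧
    Asymptotics.IsBigO (𝓝 P)
      (fun x => h (F x) - Complex.exp (Complex.I * (ζ + τ * ‖h x‖ ^ 2)) * h x)
      (fun x => ‖h x‖ ^ 4)

end

/-! At a symmetric fixed point the position vector is normal to the oval. After a rotation and
division by the radius of curvature `r`, the oval near `φ₀` becomes a germ starting at `-ig`, where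
`g` is the support value divided by `r`. Linearizing the reflection law gives trace `4g - 2` for
every `m`; ellipticity makes it less than 2, so it equals `2 cos θ` with a single angle `θ` for the
whole family. Since `r` is the sum of the support function and its second derivative, non-resonance
says that `K = cos θ` satisfies `K ≠ 0` and `2K + 1 ≠ 0`: the multiplier `e^{iθ}` has order neither
4 nor 3.

The normal form is found in Lagrangian form. One looks for a real cubic polynomial `X(w)`
(`orbitPosition`) such that the iterates `R` of `twistMap θ t` turn `w` into a sequence `X(Rᵏ w)` of
tangent angles, relative to `φ₀`, that obeys the reflection law up to `O(|w|⁴)`. Comparing harmonics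
gives the polynomial system `OrbitCoefficients`. The harmonics of weight 0, 2 and 3 can be solved
for the coefficients of `X` by non-resonance; the harmonic of weight 1 at order three is a
solvability condition, and it determines `t`. The outcome (`exists_orbitCoefficients`) is `t = A + B
cot²(mπ/n)`, with `A` and `B ≠ 0` independent of `m`.

Normalizing the Jacobian multiplies `t` by a positive number
(`IsNormalizedGerm.isTwistCoefficient_iff`), so `τ_m = 0` exactly when `A + B cot²(mπ/n) = 0`. Since
`cot²` is injective on `(0, π/2]`, this happens for at most one `m ≤ n/2`.

The twist coefficient is unique because averaging a conjugacy between two twist maps over rotations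
isolates the resonant cubic term (`twist_unique_of_conjugacy`). -/

/-! ### Integrable twist maps. -/

/-- The integrable twist map `z ↦ e^{i(θ + τ|z|²)} z`. -/
noncomputable def twistMap (θ τ : ℝ) (z : ℂ) : ℂ :=
  Complex.exp (Complex.I * (θ + τ * ‖z‖ ^ 2)) * z

theorem norm_exp_I_mul_add (θ τ r : ℝ) :
    ‖Complex.exp (Complex.I * (θ + τ * (r : ℂ) ^ 2))‖ = 1 := by
  have : Complex.I * (θ + τ * (r : ℂ) ^ 2) = ((θ + τ * r ^ 2 : ℝ) : ℂ) * Complex.I := by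
    push_cast; ring
  rw [this, Complex.norm_exp_ofReal_mul_I]

theorem norm_twistMap (θ τ : ℝ) (z : ℂ) : ‖twistMap θ τ z‖ = ‖z‖ := by
  rw [twistMap, norm_mul, norm_exp_I_mul_add, one_mul]

@[simp] theorem twistMap_zero (θ τ : ℝ) : twistMap θ τ 0 = 0 := by simp [twistMap]

theorem twistMap_twistMap (θ τ θ' τ' : ℝ) (z : ℂ) :
    twistMap θ τ (twistMap θ' τ' z) = twistMap (θ + θ') (τ + τ') z := by
  have h := norm_twistMap θ' τ' z
  conv_lhs => rw [twistMap, h]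
  rw [twistMap, twistMap, ← mul_assoc, ← Complex.exp_add]
  congr 2; push_cast; ring

theorem twistMap_rotate (θ τ ϑ : ℝ) (z : ℂ) :
    twistMap θ τ (Complex.exp (Complex.I * ϑ) * z)
      = Complex.exp (Complex.I * ϑ) * twistMap θ τ z := by
  have h : ‖Complex.exp (Complex.I * ϑ)‖ = 1 := by
    rw [mul_comm, Complex.norm_exp_ofReal_mul_I]
  rw [twistMap, twistMap, norm_mul, h, one_mul]; ring

theorem contDiff_twistMap (θ τ : ℝ) : ContDiff ℝ ∞ (twistMap θ τ) := by
  have h : ContDiff ℝ ∞ (fun z : ℂ => ((‖z‖ ^ 2 : ℝ) : ℂ)) :=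
    Complex.ofRealCLM.contDiff.comp (contDiff_norm_sq ℝ)
  have h2 : twistMap θ τ = fun z : ℂ =>
      Complex.exp (Complex.I * (θ + τ * ((‖z‖ ^ 2 : ℝ) : ℂ))) * z := by
    funext z; simp [twistMap]
  rw [h2]
  exact ((contDiff_const.mul (contDiff_const.add (contDiff_const.mul h))).cexp).mul contDiff_id

theorem tendsto_twistMap (θ τ : ℝ) : Filter.Tendsto (twistMap θ τ) (𝓝 0) (𝓝 0) := by
  have := (contDiff_twistMap θ τ).continuous.tendsto 0
  rwa [twistMap_zero] at this

/-- The cubic Taylor polynomial of the twist map. -/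
theorem twistMap_sub_isBigO (θ τ : ℝ) :
    (fun z : ℂ => twistMap θ τ z
      - Complex.exp (Complex.I * θ) * (z + Complex.I * τ * ((‖z‖ : ℂ) ^ 2 * z)))
      =O[𝓝 0] fun z => ‖z‖ ^ 5 := by
  have h0 : ∀ᶠ z : ℂ in 𝓝 0, ‖Complex.I * (τ * (‖z‖ : ℂ) ^ 2)‖ ≤ 1 := by
    have : Filter.Tendsto (fun z : ℂ => ‖Complex.I * (τ * (‖z‖ : ℂ) ^ 2)‖) (𝓝 0) (𝓝 0) := by
      have hc : Continuous (fun z : ℂ => ‖Complex.I * (τ * (‖z‖ : ℂ) ^ 2)‖) := by fun_prop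
      simpa using hc.tendsto 0
    exact (this.eventually (gt_mem_nhds one_pos)).mono fun z hz => hz.le
  refine Asymptotics.IsBigO.of_bound (τ ^ 2) ?_
  filter_upwards [h0] with z hz
  have h1 := Complex.norm_exp_sub_one_sub_id_le hz
  have e : twistMap θ τ z
      - Complex.exp (Complex.I * θ) * (z + Complex.I * τ * ((‖z‖ : ℂ) ^ 2 * z))
      = Complex.exp (Complex.I * θ) * (Complex.exp (Complex.I * (τ * (‖z‖ : ℂ) ^ 2)) - 1
        - Complex.I * (τ * (‖z‖ : ℂ) ^ 2)) * z := by
    rw [twistMap, mul_add Complex.I, Complex.exp_add]; ring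
  have h2 : ‖Complex.exp (Complex.I * θ)‖ = 1 := by
    rw [mul_comm, Complex.norm_exp_ofReal_mul_I]
  rw [e, norm_mul, norm_mul, h2, one_mul]
  have h3 : ‖Complex.I * (τ * (‖z‖ : ℂ) ^ 2)‖ ^ 2 = τ ^ 2 * ‖z‖ ^ 4 := by
    rw [norm_mul, Complex.norm_I, one_mul, norm_mul, norm_pow, Complex.norm_real,
      Complex.norm_real, norm_norm, Real.norm_eq_abs, mul_pow, sq_abs]; ring
  rw [h3] at h1
  calc _ ≤ τ ^ 2 * ‖z‖ ^ 4 * ‖z‖ := by gcongr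
    _ = _ := by rw [norm_pow, norm_norm]; ring

theorem norm_pow_isLittleO {m n : ℕ} (h : n < m) :
    (fun z : ℂ => ‖z‖ ^ m) =o[𝓝 0] fun z : ℂ => ‖z‖ ^ n := by
  have h1 : Filter.Tendsto (fun z : ℂ => ‖z‖) (𝓝 0) (𝓝 0) := by
    simpa using (continuous_norm (E := ℂ)).tendsto 0
  exact (Asymptotics.isLittleO_pow_pow (𝕜 := ℝ) h).comp_tendsto h1

/-! ### Averaging over rotations. -/

/-- The component of weight one of `k` along the circles centred at `0`. -/
noncomputable def rotationAverage (k : ℂ → ℂ) (z : ℂ) : ℂ :=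
  ∫ ϑ in (0 : ℝ)..(2 * Real.pi),
    Complex.exp (-(Complex.I * ϑ)) * k (Complex.exp (Complex.I * ϑ) * z)

theorem norm_exp_I_mul (ϑ : ℝ) : ‖Complex.exp (Complex.I * ϑ)‖ = 1 := by
  rw [mul_comm, Complex.norm_exp_ofReal_mul_I]

theorem norm_exp_neg_I_mul (ϑ : ℝ) : ‖Complex.exp (-(Complex.I * ϑ))‖ = 1 := by
  rw [Complex.exp_neg, norm_inv, norm_exp_I_mul, inv_one]

theorem exp_neg_mul_exp_I (ϑ : ℂ) :
    Complex.exp (-(Complex.I * ϑ)) * Complex.exp (Complex.I * ϑ) = 1 := by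
  rw [← Complex.exp_add]; simp

theorem rotationAverage_isLittleO {E : ℂ → ℂ} {n : ℕ}
    (h : E =o[𝓝 0] fun z => ‖z‖ ^ n) :
    rotationAverage E =o[𝓝 0] fun z => ‖z‖ ^ n := by
  rw [Asymptotics.isLittleO_iff] at h ⊢
  intro c hc
  have hpi := Real.pi_pos
  have h1 := h (c := c / (2 * Real.pi)) (by positivity)
  obtain ⟨δ, hδ, hb⟩ := Metric.eventually_nhds_iff.1 h1
  refine Metric.eventually_nhds_iff.2 ⟨δ, hδ, fun z hz => ?_⟩
  have := intervalIntegral.norm_integral_le_of_norm_le_const (a := 0) (b := 2 * Real.pi)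
    (C := c / (2 * Real.pi) * ‖z‖ ^ n)
    (f := fun ϑ : ℝ => Complex.exp (-(Complex.I * ϑ)) * E (Complex.exp (Complex.I * ϑ) * z))
    (fun ϑ _ => by
      have hn : ‖Complex.exp (Complex.I * ϑ) * z‖ = ‖z‖ := by
        rw [norm_mul, norm_exp_I_mul, one_mul]
      have := hb (y := Complex.exp (Complex.I * ϑ) * z) (by
        rw [dist_zero_right] at hz ⊢; rwa [hn])
      rw [norm_mul, norm_exp_neg_I_mul, one_mul]
      simpa [hn] using this)
  rw [rotationAverage]
  refine this.trans (le_of_eq ?_)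
  rw [sub_zero, abs_of_pos (by positivity), norm_pow, norm_norm]
  field_simp

/-- Shift the variable of integration by `ψ`; the integrand has period `2π`. -/
theorem rotationAverage_rotate (k : ℂ → ℂ) (ψ : ℝ) (z : ℂ) :
    rotationAverage k (Complex.exp (Complex.I * ψ) * z)
      = Complex.exp (Complex.I * ψ) * rotationAverage k z := by
  set G : ℝ → ℂ := fun ϑ =>
    Complex.exp (-(Complex.I * ϑ)) * k (Complex.exp (Complex.I * ϑ) * z) with hG
  have hper : Function.Periodic G (2 * Real.pi) := by
    intro ϑ
    have e1 : Complex.exp (Complex.I * ((ϑ + 2 * Real.pi : ℝ) : ℂ))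
        = Complex.exp (Complex.I * ϑ) := by
      rw [show Complex.I * ((ϑ + 2 * Real.pi : ℝ) : ℂ)
        = Complex.I * ϑ + 2 * Real.pi * Complex.I by push_cast; ring, Complex.exp_add,
        Complex.exp_two_pi_mul_I, mul_one]
    simp only [hG, Complex.exp_neg, e1]
  have h1 : rotationAverage k (Complex.exp (Complex.I * ψ) * z)
      = ∫ ϑ in (0 : ℝ)..(2 * Real.pi), Complex.exp (Complex.I * ψ) * G (ϑ + ψ) := by
    refine intervalIntegral.integral_congr fun ϑ _ => ?_
    have e1 : Complex.exp (Complex.I * ψ) * Complex.exp (-(Complex.I * ((ϑ + ψ : ℝ) : ℂ)))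
        = Complex.exp (-(Complex.I * ϑ)) := by
      rw [← Complex.exp_add]; congr 1; push_cast; ring
    have e2 : Complex.exp (Complex.I * ((ϑ + ψ : ℝ) : ℂ))
        = Complex.exp (Complex.I * ϑ) * Complex.exp (Complex.I * ψ) := by
      rw [← Complex.exp_add]; congr 1; push_cast; ring
    simp only [hG]
    rw [← mul_assoc (Complex.exp (Complex.I * ψ)), e1, e2, mul_assoc]
  rw [h1, intervalIntegral.integral_const_mul, intervalIntegral.integral_comp_add_right,
    zero_add, add_comm (2 * Real.pi), hper.intervalIntegral_add_eq ψ 0, zero_add]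
  rfl

theorem rotationAverage_smul_self (c : ℝ → ℂ) (z : ℂ) :
    rotationAverage (fun w => c ‖w‖ * w) z = 2 * Real.pi * (c ‖z‖ * z) := by
  have : rotationAverage (fun w => c ‖w‖ * w) z
      = ∫ _ in (0 : ℝ)..(2 * Real.pi), c ‖z‖ * z := by
    refine intervalIntegral.integral_congr fun ϑ _ => ?_
    beta_reduce
    rw [norm_mul, norm_exp_I_mul, one_mul]
    linear_combination (c ‖z‖ * z) * exp_neg_mul_exp_I ϑ
  rw [this, intervalIntegral.integral_const]
  simp

theorem rotationAverage_sub {k l : ℂ → ℂ} {δ : ℝ}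
    (hk : ContinuousOn k (Metric.ball 0 δ)) (hl : ContinuousOn l (Metric.ball 0 δ))
    {z : ℂ} (hz : ‖z‖ < δ) :
    rotationAverage (fun w => k w - l w) z = rotationAverage k z - rotationAverage l z := by
  have key : ∀ {k : ℂ → ℂ}, ContinuousOn k (Metric.ball 0 δ) →
      IntervalIntegrable (fun ϑ : ℝ => Complex.exp (-(Complex.I * ϑ)) *
        k (Complex.exp (Complex.I * ϑ) * z)) MeasureTheory.volume 0 (2 * Real.pi) := by
    intro k hk
    apply Continuous.intervalIntegrable
    refine Continuous.mul (by fun_prop) ?_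
    refine hk.comp_continuous (by fun_prop) fun ϑ => ?_
    rw [mem_ball_zero_iff, norm_mul, norm_exp_I_mul, one_mul]; exact hz
  rw [rotationAverage, rotationAverage, rotationAverage,
    ← intervalIntegral.integral_sub (key hk) (key hl)]
  simp only [mul_sub]

theorem rotationAverage_const_mul (c : ℂ) (k : ℂ → ℂ) (z : ℂ) :
    rotationAverage (fun w => c * k w) z = c * rotationAverage k z := by
  rw [rotationAverage, rotationAverage, ← intervalIntegral.integral_const_mul]
  refine intervalIntegral.integral_congr fun ϑ _ => ?_
  ring

theorem hasFDerivAt_twistMap (θ τ : ℝ) :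
    HasFDerivAt (twistMap θ τ)
      (ContinuousLinearMap.mul ℝ ℂ (Complex.exp (Complex.I * θ))) 0 := by
  have h1 := (twistMap_sub_isBigO θ τ).trans_isLittleO
    (norm_pow_isLittleO (show 1 < 5 by norm_num))
  have h2 : (fun z : ℂ => Complex.exp (Complex.I * θ) *
      (Complex.I * τ * ((‖z‖ : ℂ) ^ 2 * z))) =o[𝓝 0] fun z => ‖z‖ ^ 1 := by
    refine Asymptotics.IsBigO.trans_isLittleO ?_ (norm_pow_isLittleO (show 1 < 3 by norm_num))
    refine Asymptotics.IsBigO.of_bound |τ| (Filter.Eventually.of_forall fun z => ?_)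
    simp only [norm_mul, norm_exp_I_mul, one_mul, Complex.norm_I, Complex.norm_real, norm_pow,
      Real.norm_eq_abs]
    exact le_of_eq (by rw [abs_norm]; ring)
  have h3 := h1.add h2
  rw [hasFDerivAt_iff_isLittleO_nhds_zero]
  refine Asymptotics.IsLittleO.congr (h3.trans_isBigO
    (Asymptotics.IsBigO.of_bound 1 (Filter.Eventually.of_forall fun z => by simp))) ?_
    (fun z => rfl)
  intro z
  simp only [zero_add, twistMap_zero, sub_zero, ContinuousLinearMap.mul_apply']
  ring

/-! ### Uniqueness of the twist coefficient under conjugacy. -/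

/-- A real linear endomorphism of `ℂ` of determinant one which intertwines two rotations, not
both real, is a rotation. -/
theorem linear_intertwining_rotation (D : ℂ →L[ℝ] ℂ) {l l' : ℂ} (hl : l.im ≠ 0) (hl1 : ‖l‖ = 1)
    (hJ : ((starRingEnd ℂ) (D 1) * D Complex.I).im = 1)
    (h : ∀ v, D (l * v) = l' * D v) :
    l' = l ∧ ‖D 1‖ = 1 ∧ ∀ v, D v = D 1 * v := by
  have hD : ∀ v : ℂ, D v = v.re * D 1 + v.im * D Complex.I := by
    intro v
    have : v = v.re • (1 : ℂ) + v.im • Complex.I := by simp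
    conv_lhs => rw [this, map_add, map_smul, map_smul]
    simp
  have h1 := h 1
  have h2 := h Complex.I
  rw [mul_one, hD l] at h1
  rw [hD (l * Complex.I)] at h2
  simp only [Complex.mul_re, Complex.mul_im, Complex.I_re, Complex.I_im, mul_zero, mul_one,
    zero_sub, add_zero] at h2
  set u := D 1
  set v := D Complex.I
  have hl2 : l.re ^ 2 + l.im ^ 2 = 1 := by
    have := Complex.sq_norm l
    rw [hl1, Complex.normSq_apply] at this; linarith
  -- `u - i v` is an eigenvector
  have e1 : (l' - l) * (u - Complex.I * v) = 0 := by
    have hle : l = l.re + l.im * Complex.I := (Complex.re_add_im l).symm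
    push_cast at h2
    rw [hle]
    linear_combination (-1 : ℂ) * h1 + Complex.I * h2 + (l.im * v) * Complex.I_sq
  have e2 : (l' - (starRingEnd ℂ) l) * (u + Complex.I * v) = 0 := by
    have hle : (starRingEnd ℂ) l = l.re - l.im * Complex.I := by
      apply Complex.ext <;> simp
    push_cast at h2
    rw [hle]
    linear_combination (-1 : ℂ) * h1 - Complex.I * h2 + (l.im * v) * Complex.I_sq
  -- Up to a factor 2 this is the complex linear part of `D`. If it vanished, `D` would be
  -- antilinear and its determinant would be `-‖v‖² ≤ 0`.
  have hne : u - Complex.I * v ≠ 0 := by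
    intro h0
    have hu : u = Complex.I * v := by linear_combination h0
    rw [hu] at hJ
    simp at hJ
    nlinarith [sq_nonneg v.re, sq_nonneg v.im]
  have hll : l' = l := by
    rcases mul_eq_zero.1 e1 with h0 | h0
    · linear_combination h0
    · exact absurd h0 hne
  -- The antilinear part has multiplier `conj l`, which differs from `l` because `l` is not real;
  -- hence it vanishes.
  have hv : v = Complex.I * u := by
    rcases mul_eq_zero.1 e2 with h0 | h0
    · exfalso
      rw [hll] at h0
      have := congrArg Complex.im h0
      simp at this
      exact hl this
    · linear_combination -Complex.I * h0 + v * Complex.I_sq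
  refine ⟨hll, ?_, fun w => ?_⟩
  · rw [hv] at hJ
    have h3 : ‖u‖ ^ 2 = 1 := by
      rw [Complex.sq_norm, Complex.normSq_apply]
      simp at hJ; linarith
    nlinarith [norm_nonneg u]
  · rw [hD w, hv]
    conv_rhs => rw [← Complex.re_add_im w]
    ring

/-- In the cubic term of a twist map a conjugacy may be replaced by its linear part, at a cost of
`o(|z|³)`. -/
theorem norm_sq_mul_self_sub_isLittleO {k : ℂ → ℂ} {A : ℂ} (hA : ‖A‖ = 1)
    (hk : (fun z => k z - A * z) =o[𝓝 0] fun z : ℂ => ‖z‖) :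
    (fun z => (‖k z‖ : ℂ) ^ 2 * k z - (‖z‖ : ℂ) ^ 2 * (A * z)) =o[𝓝 0]
      fun z => ‖z‖ ^ 3 := by
  have e : (fun z => (‖k z‖ : ℂ) ^ 2 * k z - (‖z‖ : ℂ) ^ 2 * (A * z))
      = fun z => (‖k z‖ : ℂ) ^ 2 * (k z - A * z)
        + ((‖k z‖ - ‖z‖ : ℝ) : ℂ) * (((‖k z‖ + ‖z‖ : ℝ) : ℂ) * (A * z)) := by
    funext z; push_cast; ring
  have hAz : (fun z : ℂ => A * z) =O[𝓝 0] fun z => ‖z‖ :=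
    Asymptotics.IsBigO.of_bound 1 (Filter.Eventually.of_forall fun z => by simp [hA])
  have hkO : k =O[𝓝 0] fun z => ‖z‖ := by
    have := hk.isBigO.add hAz
    simpa using this
  have hzO : (fun z : ℂ => ‖z‖) =O[𝓝 0] fun z : ℂ => ‖z‖ := Asymptotics.isBigO_refl _ _
  have hd : (fun z => ((‖k z‖ - ‖z‖ : ℝ) : ℂ)) =o[𝓝 0] fun z : ℂ => ‖z‖ := by
    refine (Asymptotics.IsBigO.of_norm_le fun z => ?_).trans_isLittleO hk.norm_left
    rw [Complex.norm_real, Real.norm_eq_abs]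
    have := abs_norm_sub_norm_le (k z) (A * z)
    rwa [norm_mul, hA, one_mul] at this
  have hs : (fun z => ((‖k z‖ + ‖z‖ : ℝ) : ℂ)) =O[𝓝 0] fun z : ℂ => ‖z‖ := by
    have := hkO.norm_left.add hzO
    refine Asymptotics.IsBigO.of_norm_left (this.norm_left.congr_left fun z => ?_)
    rw [Complex.norm_real]
  have hn : (fun z => (‖k z‖ : ℂ) ^ 2) =O[𝓝 0] fun z : ℂ => ‖z‖ ^ 2 := by
    have := (hkO.norm_left).pow 2
    exact Asymptotics.IsBigO.of_norm_left (by simpa using this.norm_left)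
  rw [e]
  refine Asymptotics.IsLittleO.add ((hn.mul_isLittleO hk).congr_right fun z => by ring)
    ((hd.mul_isBigO (hs.mul hAz)).congr_right fun z => by ring)

/-- The linear part of `k` is a rotation `z ↦ Az`, and both linear multipliers agree. Averaging the
conjugacy equation removes every term of `k` except its weight-one component `B(z) ~ 2πAz`, and what
remains at order three is `(τ' - τ)|z|²z`. No Taylor expansion of `k` is needed, and the multiplier
only has to be non-real, so resonances do no harm. -/
theorem twist_unique_of_conjugacy {k : ℂ → ℂ} {D : ℂ →L[ℝ] ℂ} {θ τ θ' τ' : ℝ}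
    (hk0 : k 0 = 0) (hkD : HasFDerivAt k D 0) (hkc : ∀ᶠ z in 𝓝 0, ContinuousAt k z)
    (hJ : ((starRingEnd ℂ) (D 1) * D Complex.I).im = 1) (hθ : Real.sin θ ≠ 0)
    (hconj : (fun z => k (twistMap θ τ z) - twistMap θ' τ' (k z)) =o[𝓝 0] fun z => ‖z‖ ^ 3) :
    τ' = τ := by
  set l := Complex.exp (Complex.I * θ) with hl
  set l' := Complex.exp (Complex.I * θ') with hl'
  have hlim : l.im ≠ 0 := by
    rw [hl, mul_comm, Complex.exp_ofReal_mul_I_im]; exact hθ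
  have hl1 : ‖l‖ = 1 := norm_exp_I_mul θ
  -- the linear part
  have hlin : ∀ v, D (l * v) = l' * D v := by
    have h1 : HasFDerivAt (fun z => k (twistMap θ τ z))
        (D.comp (ContinuousLinearMap.mul ℝ ℂ l)) 0 := by
      have hkD' : HasFDerivAt k D (twistMap θ τ 0) := by simpa using hkD
      exact hkD'.comp 0 (hasFDerivAt_twistMap θ τ)
    have h2 : HasFDerivAt (fun z => twistMap θ' τ' (k z))
        ((ContinuousLinearMap.mul ℝ ℂ l').comp D) 0 := by
      have h2' : HasFDerivAt (twistMap θ' τ') (ContinuousLinearMap.mul ℝ ℂ l') (k 0) := by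
        rw [hk0]; exact hasFDerivAt_twistMap θ' τ'
      exact h2'.comp 0 hkD
    have h3 := h1.sub h2
    have h4 : HasFDerivAt (fun z => k (twistMap θ τ z) - twistMap θ' τ' (k z))
        (0 : ℂ →L[ℝ] ℂ) 0 := by
      rw [hasFDerivAt_iff_isLittleO_nhds_zero]
      refine Asymptotics.IsLittleO.congr ((hconj.trans
        (norm_pow_isLittleO (show 1 < 3 by norm_num))).trans_isBigO
        (Asymptotics.IsBigO.of_bound 1 (Filter.Eventually.of_forall fun z => by simp))) ?_
        (fun z => rfl)
      intro z
      simp [hk0]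
    have h5 := h3.unique h4
    intro v
    have := congrArg (fun L : ℂ →L[ℝ] ℂ => L v) h5
    simp only [sub_apply, ContinuousLinearMap.comp_apply,
      ContinuousLinearMap.mul_apply', zero_apply] at this
    exact sub_eq_zero.1 this
  obtain ⟨hll, hA, hDv⟩ := linear_intertwining_rotation D hlim hl1 hJ hlin
  set A := D 1 with hAdef
  have hkA : (fun z => k z - A * z) =o[𝓝 0] fun z : ℂ => ‖z‖ := by
    have := (hasFDerivAt_iff_isLittleO_nhds_zero.1 hkD).norm_right
    simpa [hk0, hDv] using this
  have hkO : k =O[𝓝 0] fun z : ℂ => ‖z‖ := by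
    have := hkA.isBigO.add (Asymptotics.IsBigO.of_bound (f := fun z : ℂ => A * z) 1
      (Filter.Eventually.of_forall fun z => by simp [hA]))
    simpa using this
  -- the equation up to order three
  have hE : (fun z => (k (twistMap θ τ z) - l * k z)
      - (l * Complex.I * τ' * A) * ((‖z‖ : ℂ) ^ 2 * z)) =o[𝓝 0] fun z => ‖z‖ ^ 3 := by
    have hk0' : Filter.Tendsto k (𝓝 0) (𝓝 0) := by
      have := hkD.continuousAt.tendsto
      rwa [hk0] at this
    have h1 : (fun z => twistMap θ' τ' (k z) - l' * (k z + Complex.I * τ' *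
        ((‖k z‖ : ℂ) ^ 2 * k z))) =o[𝓝 0] fun z => ‖z‖ ^ 3 := by
      refine (((twistMap_sub_isBigO θ' τ').comp_tendsto hk0').trans ?_).trans_isLittleO
        (norm_pow_isLittleO (show 3 < 5 by norm_num))
      exact (hkO.norm_left).pow 5
    have h2 := (norm_sq_mul_self_sub_isLittleO hA hkA).const_mul_left (l' * (Complex.I * τ'))
    refine ((hconj.add h1).add h2).congr_left fun z => ?_
    rw [hll]; ring
  have hav := rotationAverage_isLittleO hE
  obtain ⟨δ, hδ, hcont⟩ := Metric.eventually_nhds_iff_ball.1 hkc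
  have hkball : ContinuousOn k (Metric.ball 0 δ) := fun z hz =>
    (hcont z hz).continuousWithinAt
  have hkf : ContinuousOn (fun z => k (twistMap θ τ z)) (Metric.ball 0 δ) := by
    refine hkball.comp (contDiff_twistMap θ τ).continuous.continuousOn fun z hz => ?_
    rw [mem_ball_zero_iff] at hz ⊢
    rwa [norm_twistMap]
  -- the average of `k`
  set B := rotationAverage k with hB
  have hBA : (fun z => B z - 2 * Real.pi * (A * z)) =o[𝓝 0] fun z : ℂ => ‖z‖ ^ 1 := by
    have := rotationAverage_isLittleO (n := 1) (hkA.congr_right fun z => (pow_one ‖z‖).symm)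
    refine this.congr' ?_ Filter.EventuallyEq.rfl
    filter_upwards [Metric.ball_mem_nhds (0 : ℂ) hδ] with z hz
    rw [rotationAverage_sub hkball (by fun_prop) (mem_ball_zero_iff.1 hz)]
    have := rotationAverage_smul_self (fun _ => A) z
    rw [this]
  -- On each circle about 0 the twist map is a single rotation, so equivariance of the average makes
  -- this an exact identity.
  have hfB : ∀ z, rotationAverage (fun w => k (twistMap θ τ w)) z
      = Complex.exp (Complex.I * ((θ + τ * ‖z‖ ^ 2 : ℝ) : ℂ)) * B z := by
    intro z
    rw [hB, ← rotationAverage_rotate]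
    refine intervalIntegral.integral_congr fun ϑ _ => ?_
    beta_reduce
    rw [twistMap_rotate, twistMap]
    push_cast; rfl
  have hmain : (fun z => (Complex.exp (Complex.I * ((θ + τ * ‖z‖ ^ 2 : ℝ) : ℂ)) * B z - l * B z)
      - 2 * Real.pi * ((l * Complex.I * τ' * A) * (‖z‖ : ℂ) ^ 2 * z)) =o[𝓝 0]
      fun z => ‖z‖ ^ 3 := by
    refine hav.congr' ?_ Filter.EventuallyEq.rfl
    filter_upwards [Metric.ball_mem_nhds (0 : ℂ) hδ] with z hz
    have hz' := mem_ball_zero_iff.1 hz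
    have c1 : ContinuousOn (fun w => k (twistMap θ τ w) - l * k w) (Metric.ball 0 δ) :=
      hkf.sub (continuousOn_const.mul hkball)
    rw [rotationAverage_sub c1 (by fun_prop) hz',
      rotationAverage_sub hkf (l := fun w => l * k w) (continuousOn_const.mul hkball) hz', hfB,
      rotationAverage_const_mul, rotationAverage_const_mul,
      rotationAverage_smul_self (fun r => (r : ℂ) ^ 2)]
    ring
  -- expansion of the rotation number
  have hBO : B =O[𝓝 0] fun z : ℂ => ‖z‖ := by
    have := hBA.isBigO.add (Asymptotics.IsBigO.of_bound
      (f := fun z : ℂ => 2 * Real.pi * (A * z)) (2 * Real.pi)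
      (Filter.Eventually.of_forall fun z => by simp [hA, abs_of_pos Real.pi_pos]))
    simpa using this
  have hexp : (fun z => (Complex.exp (Complex.I *
      ((θ + τ * ‖z‖ ^ 2 : ℝ) : ℂ)) * B z - l * B z)
      - 2 * Real.pi * ((l * Complex.I * τ * A) * (‖z‖ : ℂ) ^ 2 * z)) =o[𝓝 0]
      fun z => ‖z‖ ^ 3 := by
    have hq : (fun z : ℂ => Complex.exp (Complex.I * ((θ + τ * ‖z‖ ^ 2 : ℝ) : ℂ)) - l
        - l * (Complex.I * τ * (‖z‖ : ℂ) ^ 2)) =O[𝓝 0] fun z => ‖z‖ ^ 4 := by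
      have h0 : ∀ᶠ z : ℂ in 𝓝 0, ‖Complex.I * (τ * (‖z‖ : ℂ) ^ 2)‖ ≤ 1 := by
        have : Filter.Tendsto (fun z : ℂ => ‖Complex.I * (τ * (‖z‖ : ℂ) ^ 2)‖) (𝓝 0) (𝓝 0) := by
          have hc : Continuous (fun z : ℂ => ‖Complex.I * (τ * (‖z‖ : ℂ) ^ 2)‖) := by fun_prop
          simpa using hc.tendsto 0
        exact (this.eventually (gt_mem_nhds one_pos)).mono fun z hz => hz.le
      refine Asymptotics.IsBigO.of_bound (τ ^ 2) ?_
      filter_upwards [h0] with z hz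
      have h1 := Complex.norm_exp_sub_one_sub_id_le hz
      have e : Complex.exp (Complex.I * ((θ + τ * ‖z‖ ^ 2 : ℝ) : ℂ)) - l
          - l * (Complex.I * τ * (‖z‖ : ℂ) ^ 2)
          = l * (Complex.exp (Complex.I * (τ * (‖z‖ : ℂ) ^ 2)) - 1
            - Complex.I * (τ * (‖z‖ : ℂ) ^ 2)) := by
        push_cast
        rw [mul_add Complex.I, Complex.exp_add]; ring
      rw [e, norm_mul, hl1, one_mul]
      refine h1.trans (le_of_eq ?_)
      rw [norm_mul, Complex.norm_I, one_mul, norm_mul, norm_pow, Complex.norm_real,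
        Complex.norm_real, norm_norm, Real.norm_eq_abs, mul_pow, sq_abs, norm_pow, norm_norm]
      ring
    have h1 : (fun z => (Complex.exp (Complex.I * ((θ + τ * ‖z‖ ^ 2 : ℝ) : ℂ)) - l
        - l * (Complex.I * τ * (‖z‖ : ℂ) ^ 2)) * B z) =o[𝓝 0] fun z => ‖z‖ ^ 3 :=
      ((hq.mul hBO).congr_right fun z => by ring : _ =O[𝓝 0] fun z : ℂ => ‖z‖ ^ 5).trans_isLittleO
        (norm_pow_isLittleO (show 3 < 5 by norm_num))
    have h2 : (fun z => (l * (Complex.I * τ * (‖z‖ : ℂ) ^ 2)) *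
        (B z - 2 * Real.pi * (A * z))) =o[𝓝 0] fun z => ‖z‖ ^ 3 := by
      have hO : (fun z : ℂ => l * (Complex.I * τ * (‖z‖ : ℂ) ^ 2)) =O[𝓝 0]
          fun z => ‖z‖ ^ 2 := by
        refine Asymptotics.IsBigO.of_bound |τ| (Filter.Eventually.of_forall fun z => ?_)
        simp [hl1]
      exact (hO.mul_isLittleO hBA).congr_right fun z => by ring
    refine (h1.add h2).congr_left fun z => ?_
    ring
  have hdiff := hexp.sub hmain
  have hconst : (fun z : ℂ => 2 * Real.pi * ((l * Complex.I * (τ' - τ) * A) *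
      ((‖z‖ : ℂ) ^ 2 * z))) =o[𝓝 0] fun z => ‖z‖ ^ 3 := by
    refine hdiff.congr_left fun z => ?_
    ring
  by_contra hne
  have hpos : 0 < 2 * Real.pi * |τ' - τ| := by
    have := Real.pi_pos
    have := abs_pos.2 (sub_ne_zero.2 hne)
    positivity
  have h3 := hconst.def (half_pos hpos)
  obtain ⟨δ', hδ', hb⟩ := Metric.eventually_nhds_iff_ball.1 h3
  have := hb ((δ' / 2 : ℝ) : ℂ) (by
    rw [mem_ball_zero_iff, Complex.norm_real, Real.norm_eq_abs, abs_of_pos (by positivity)]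
    linarith)
  have hτ : ‖((τ' : ℂ) - τ)‖ = |τ' - τ| := by
    rw [← Complex.ofReal_sub, Complex.norm_real, Real.norm_eq_abs]
  simp only [norm_mul, hl1, Complex.norm_I, hA, hτ, Complex.norm_real, norm_pow,
    Real.norm_eq_abs, Complex.norm_ofNat, abs_of_pos Real.pi_pos, abs_abs] at this
  have h4 : 0 < |δ' / 2| ^ 3 := by positivity
  nlinarith

/-! ### Twist coefficients from a parametrization. -/

theorem ContDiffAt.sub_isBigO {E F : Type*} [NormedAddCommGroup E] [NormedSpace ℝ E]
    [NormedAddCommGroup F] [NormedSpace ℝ F] {h : E → F} {P : E} (hh : ContDiffAt ℝ ∞ h P)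
    {ι : Type*} {l : Filter ι} {u v : ι → E} (hu : Filter.Tendsto u l (𝓝 P))
    (hv : Filter.Tendsto v l (𝓝 P)) :
    (fun i => h (u i) - h (v i)) =O[l] fun i => u i - v i :=
  (hh.hasStrictFDerivAt (by simp)).isBigO_sub.comp_tendsto (hu.prodMk_nhds hv)

/-- A real linear map from `ℂ` to `ℝ × ℝ` of determinant one, as an equivalence. -/
theorem exists_equiv_of_det_eq_one (L : ℂ →L[ℝ] ℝ × ℝ)
    (hJ : (L 1).1 * (L Complex.I).2 - (L 1).2 * (L Complex.I).1 = 1) :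
    ∃ e : ℂ ≃L[ℝ] ℝ × ℝ, (e : ℂ →L[ℝ] ℝ × ℝ) = L := by
  have hL : ∀ v : ℂ, L v = v.re • L 1 + v.im • L Complex.I := by
    intro v
    have : v = v.re • (1 : ℂ) + v.im • Complex.I := by simp
    conv_lhs => rw [this, map_add, map_smul, map_smul]
  have hinj : Function.Injective (L : ℂ →ₗ[ℝ] ℝ × ℝ) := by
    refine (injective_iff_map_eq_zero _).2 fun v hv => ?_
    have hv' : L v = 0 := hv
    rw [hL] at hv'
    have h1 := congrArg Prod.fst hv'
    have h2 := congrArg Prod.snd hv'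
    simp only [Prod.fst_add, Prod.snd_add, Prod.smul_fst, Prod.smul_snd, smul_eq_mul,
      Prod.fst_zero, Prod.snd_zero] at h1 h2
    apply Complex.ext
    · simp only [Complex.zero_re]
      linear_combination (L Complex.I).2 * h1 - (L Complex.I).1 * h2 - v.re * hJ
    · simp only [Complex.zero_im]
      linear_combination (L 1).1 * h2 - (L 1).2 * h1 - v.im * hJ
  refine ⟨(LinearEquiv.ofInjectiveOfFinrankEq (L : ℂ →ₗ[ℝ] ℝ × ℝ) hinj
    (by simp)).toContinuousLinearEquiv, ?_⟩
  ext v <;> rfl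

/-- The coordinate `h` is the local inverse of `Φ`. Working with `Φ` avoids inverting any series:
only its derivative at 0 and the approximate conjugacy matter. -/
theorem isTwistCoefficient_of_parametrization {F : ℝ × ℝ → ℝ × ℝ} {P : ℝ × ℝ} {Φ : ℂ → ℝ × ℝ}
    {θ τ : ℝ} (hFP : F P = P) (hΦ : ∀ᶠ z in 𝓝 0, ContDiffAt ℝ ∞ Φ z) (hΦ0 : Φ 0 = P)
    (hJ : (fderiv ℝ Φ 0 1).1 * (fderiv ℝ Φ 0 Complex.I).2
      - (fderiv ℝ Φ 0 1).2 * (fderiv ℝ Φ 0 Complex.I).1 = 1)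
    (hconj : (fun z => F (Φ z) - Φ (twistMap θ τ z)) =O[𝓝 0] fun z => ‖z‖ ^ 4) :
    IsTwistCoefficient F P τ := by
  obtain ⟨e, he⟩ := exists_equiv_of_det_eq_one _ hJ
  have hΦs : ContDiffAt ℝ ∞ Φ 0 := hΦ.self_of_nhds
  have hd : HasFDerivAt Φ (e : ℂ →L[ℝ] ℝ × ℝ) 0 := by
    rw [he]; exact (hΦs.differentiableAt (by simp)).hasFDerivAt
  let H := hΦs.toOpenPartialHomeomorph Φ hd (by simp)
  have hHc : (H : ℂ → ℝ × ℝ) = Φ := rfl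
  have h0s : (0 : ℂ) ∈ H.source := hΦs.mem_toOpenPartialHomeomorph_source hd (by simp)
  have hPt : P ∈ H.target := by rw [← hΦ0]; exact H.map_source h0s
  have hP0 : H.symm P = 0 := by
    have := H.left_inv h0s
    rwa [hHc, hΦ0] at this
  have hsymm : Filter.Tendsto H.symm (𝓝 P) (𝓝 0) := by
    have := (H.continuousAt_symm hPt).tendsto
    rwa [hP0] at this
  have hinv : ∀ᶠ x in 𝓝 P, Φ (H.symm x) = x := by
    filter_upwards [H.open_target.mem_nhds hPt] with x hx
    exact H.right_inv hx
  -- Smoothness is required on a neighbourhood of `P`; it holds because the derivative of `Φ` stays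
  -- invertible near 0.
  have hsmooth : ∀ᶠ x in 𝓝 P, ContDiffAt ℝ ∞ H.symm x := by
    have h1 : ∀ᶠ z in 𝓝 (0 : ℂ), ∃ e' : ℂ ≃L[ℝ] ℝ × ℝ,
        HasFDerivAt Φ (e' : ℂ →L[ℝ] ℝ × ℝ) z := by
      have hc : ContinuousAt (fderiv ℝ Φ) 0 :=
        (hΦs.fderiv_right (m := 0) (by simp)).continuousAt
      have hn := hc.eventually (by rw [← he]; exact ContinuousLinearEquiv.nhds e)
      filter_upwards [hn, hΦ] with z ⟨e', he'⟩ hz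
      exact ⟨e', by rw [he']; exact (hz.differentiableAt (by simp)).hasFDerivAt⟩
    filter_upwards [hsymm.eventually (h1.and hΦ), H.open_target.mem_nhds hPt]
      with x ⟨⟨e', he'⟩, hz⟩ hx
    exact H.contDiffAt_symm hx he' hz
  have hder : HasFDerivAt H.symm (e.symm : ℝ × ℝ →L[ℝ] ℂ) P := by
    refine HasFDerivAt.of_local_left_inverse (f := Φ) (H.continuousAt_symm hPt) ?_ hinv
    rw [hP0]; exact hd
  refine ⟨hFP, H.symm, θ, hsmooth, hP0, ?_, ?_⟩
  · rw [hder.fderiv]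
    set v1 := fderiv ℝ Φ 0 1 with hv1
    set v2 := fderiv ℝ Φ 0 Complex.I with hv2
    have e1 : e 1 = v1 := by rw [hv1, ← he]; rfl
    have e2 : e Complex.I = v2 := by rw [hv2, ← he]; rfl
    have hs : ∀ a b : ℝ, e ((a : ℂ) + b * Complex.I) = a • v1 + b • v2 := by
      intro a b
      rw [← e1, ← e2, ← map_smul, ← map_smul, ← map_add]
      congr 1; simp
    -- For determinant one, the inverse matrix is the adjugate.
    have s1 : e.symm (1, 0) = (v2.2 : ℂ) + (-v1.2 : ℝ) * Complex.I := by
      rw [ContinuousLinearEquiv.symm_apply_eq, hs]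
      ext
      · simp; linarith
      · simp; ring
    have s2 : e.symm (0, 1) = (-v2.1 : ℝ) + (v1.1 : ℝ) * Complex.I := by
      rw [ContinuousLinearEquiv.symm_apply_eq, hs]
      ext
      · simp; ring
      · simp; linarith
    simp only [ContinuousLinearEquiv.coe_coe, s1, s2]
    simp
    linarith
  · have hFt : Filter.Tendsto (fun z => F (Φ z)) (𝓝 0) (𝓝 P) := by
      have h1 := hconj.trans_tendsto (by
        have : Continuous fun z : ℂ => ‖z‖ ^ 4 := by fun_prop
        simpa using this.tendsto 0)
      have h2 : Filter.Tendsto (fun z => Φ (twistMap θ τ z)) (𝓝 0) (𝓝 P) := by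
        have := hΦs.continuousAt.tendsto
        rw [hΦ0] at this
        exact this.comp (tendsto_twistMap θ τ)
      simpa using h1.add h2
    have hΦt : Filter.Tendsto (fun z => Φ (twistMap θ τ z)) (𝓝 0) (𝓝 P) := by
      have := hΦs.continuousAt.tendsto
      rw [hΦ0] at this
      exact this.comp (tendsto_twistMap θ τ)
    have hO := (hsmooth.self_of_nhds.sub_isBigO hFt hΦt).trans hconj
    have hO' := hO.comp_tendsto hsymm
    refine (hO'.congr' ?_ Filter.EventuallyEq.rfl)
    have hleft : ∀ᶠ x in 𝓝 P, twistMap θ τ (H.symm x) ∈ H.source :=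
      ((tendsto_twistMap θ τ).comp hsymm).eventually (H.open_source.mem_nhds h0s)
    filter_upwards [hinv, hleft] with x hx hl
    have := H.left_inv hl
    rw [hHc] at this
    simp only [Function.comp_apply, hx, this]
    rfl

/-- Any other normalizing coordinate `h` gives a conjugacy `h ∘ Φ` between the two twist maps, of
determinant one at 0. -/
theorem twistCoefficient_unique {F : ℝ × ℝ → ℝ × ℝ} {P : ℝ × ℝ} {Φ : ℂ → ℝ × ℝ}
    {θ τ : ℝ} (hθ : Real.sin θ ≠ 0) (hΦ : ∀ᶠ z in 𝓝 0, ContDiffAt ℝ ∞ Φ z) (hΦ0 : Φ 0 = P)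
    (hJ : (fderiv ℝ Φ 0 1).1 * (fderiv ℝ Φ 0 Complex.I).2
      - (fderiv ℝ Φ 0 1).2 * (fderiv ℝ Φ 0 Complex.I).1 = 1)
    (hconj : (fun z => F (Φ z) - Φ (twistMap θ τ z)) =O[𝓝 0] fun z => ‖z‖ ^ 4)
    {τ' : ℝ} (h' : IsTwistCoefficient F P τ') : τ' = τ := by
  obtain ⟨-, h, θ', hsm, hP, hJh, hh⟩ := h'
  have hΦs : ContDiffAt ℝ ∞ Φ 0 := hΦ.self_of_nhds
  have hΦt : Filter.Tendsto Φ (𝓝 0) (𝓝 P) := by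
    have := hΦs.continuousAt.tendsto
    rwa [hΦ0] at this
  have hΦf : Filter.Tendsto (fun z => Φ (twistMap θ τ z)) (𝓝 0) (𝓝 P) :=
    hΦt.comp (tendsto_twistMap θ τ)
  have hFt : Filter.Tendsto (fun z => F (Φ z)) (𝓝 0) (𝓝 P) := by
    have h1 := hconj.trans_tendsto (by
      have : Continuous fun z : ℂ => ‖z‖ ^ 4 := by fun_prop
      simpa using this.tendsto 0)
    simpa using h1.add hΦf
  have hhs : ContDiffAt ℝ ∞ h P := hsm.self_of_nhds
  have hdΦ : HasFDerivAt Φ (fderiv ℝ Φ 0) 0 := (hΦs.differentiableAt (by simp)).hasFDerivAt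
  have hdh : HasFDerivAt h (fderiv ℝ h P) (Φ 0) := by
    rw [hΦ0]; exact (hhs.differentiableAt (by simp)).hasFDerivAt
  have hD := hdh.comp 0 hdΦ
  have hkO : (h ∘ Φ) =O[𝓝 0] fun z : ℂ => ‖z‖ := by
    have := hD.differentiableAt.isBigO_sub
    exact this.norm_right.congr (fun z => by simp [hΦ0, hP]) (fun z => by simp)
  refine twist_unique_of_conjugacy (k := h ∘ Φ) (θ := θ) (θ' := θ') (by simp [hΦ0, hP]) hD
    ?_ ?_ hθ ?_
  · filter_upwards [hΦ, hΦt.eventually hsm] with z hz1 hz2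
    exact hz2.continuousAt.comp hz1.continuousAt
  · have hL : ∀ v : ℝ × ℝ, fderiv ℝ h P v
        = v.1 * fderiv ℝ h P (1, 0) + v.2 * fderiv ℝ h P (0, 1) := by
      intro v
      have : v = v.1 • ((1 : ℝ), (0 : ℝ)) + v.2 • ((0 : ℝ), (1 : ℝ)) := by ext <;> simp
      conv_lhs => rw [this, map_add, map_smul, map_smul]
      simp
    rw [ContinuousLinearMap.comp_apply, ContinuousLinearMap.comp_apply, hL (fderiv ℝ Φ 0 1),
      hL (fderiv ℝ Φ 0 Complex.I)]
    set v1 := fderiv ℝ Φ 0 1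
    set v2 := fderiv ℝ Φ 0 Complex.I
    set x := fderiv ℝ h P (1, 0)
    set y := fderiv ℝ h P (0, 1)
    simp only [Complex.mul_im, Complex.conj_re, Complex.conj_im, Complex.add_re, Complex.add_im,
      Complex.mul_re, Complex.ofReal_re, Complex.ofReal_im, zero_mul, sub_zero, add_zero]
      at hJh ⊢
    linear_combination (v1.1 * v2.2 - v1.2 * v2.1) * hJh + hJ
  · have h1 := (hhs.sub_isBigO hΦf hFt).trans (hconj.symm.trans (Asymptotics.isBigO_refl _ _))
    have h2 := (hh.comp_tendsto hΦt).trans (hkO.norm_left.pow 4)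
    refine ((h1.add h2).trans_isLittleO (norm_pow_isLittleO (show 3 < 4 by norm_num))).congr_left
      fun z => ?_
    simp [twistMap]

/-! ### Calculus of cubic expansions. -/

/-- `f = a₀ + a₁ + a₂ + a₃ + O(|z|⁴)` as `z → 0`, where `aᵢ = O(|z|ⁱ)`. -/
structure HasCubicExpansion (f : ℂ → ℝ) (a₀ : ℝ) (a₁ a₂ a₃ : ℂ → ℝ) : Prop where
  one : a₁ =O[𝓝 0] fun z => ‖z‖ ^ 1
  two : a₂ =O[𝓝 0] fun z => ‖z‖ ^ 2
  three : a₃ =O[𝓝 0] fun z => ‖z‖ ^ 3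
  rem : (fun z => f z - (a₀ + a₁ z + a₂ z + a₃ z)) =O[𝓝 0] fun z => ‖z‖ ^ 4

theorem norm_pow_isBigO {m n : ℕ} (h : n ≤ m) :
    (fun z : ℂ => ‖z‖ ^ m) =O[𝓝 0] fun z : ℂ => ‖z‖ ^ n := by
  rcases h.eq_or_lt with rfl | h
  · exact Asymptotics.isBigO_refl _ _
  · exact (norm_pow_isLittleO h).isBigO

theorem isBigO_mul_norm_pow {f g : ℂ → ℝ} {i j k : ℕ} (hf : f =O[𝓝 0] fun z => ‖z‖ ^ i)
    (hg : g =O[𝓝 0] fun z => ‖z‖ ^ j) (h : k ≤ i + j) :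
    (fun z => f z * g z) =O[𝓝 0] fun z => ‖z‖ ^ k :=
  ((hf.mul hg).congr_right fun _ => (pow_add _ _ _).symm).trans (norm_pow_isBigO h)

theorem const_isBigO_norm_pow_zero (c : ℝ) :
    (fun _ : ℂ => c) =O[𝓝 0] fun z => ‖z‖ ^ 0 := by
  simpa using Asymptotics.isBigO_const_const c (one_ne_zero (α := ℝ)) _

namespace HasCubicExpansion

variable {f g : ℂ → ℝ} {a₀ b₀ : ℝ} {a₁ a₂ a₃ b₁ b₂ b₃ : ℂ → ℝ}

theorem congr (hf : HasCubicExpansion f a₀ a₁ a₂ a₃) (h₀ : a₀ = b₀) (h₁ : ∀ z, a₁ z = b₁ z)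
    (h₂ : ∀ z, a₂ z = b₂ z) (h₃ : ∀ z, a₃ z = b₃ z) : HasCubicExpansion f b₀ b₁ b₂ b₃ := by
  obtain rfl : a₁ = b₁ := funext h₁
  obtain rfl : a₂ = b₂ := funext h₂
  obtain rfl : a₃ = b₃ := funext h₃
  rwa [← h₀]

theorem const (c : ℝ) : HasCubicExpansion (fun _ => c) c (fun _ => 0) (fun _ => 0) (fun _ => 0) :=
  ⟨Asymptotics.isBigO_zero _ _, Asymptotics.isBigO_zero _ _, Asymptotics.isBigO_zero _ _, by
    simpa using Asymptotics.isBigO_zero _ _⟩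

theorem add (hf : HasCubicExpansion f a₀ a₁ a₂ a₃) (hg : HasCubicExpansion g b₀ b₁ b₂ b₃) :
    HasCubicExpansion (fun z => f z + g z) (a₀ + b₀) (fun z => a₁ z + b₁ z)
      (fun z => a₂ z + b₂ z) (fun z => a₃ z + b₃ z) :=
  ⟨hf.one.add hg.one, hf.two.add hg.two, hf.three.add hg.three,
    (hf.rem.add hg.rem).congr_left fun z => by ring⟩

theorem const_mul (c : ℝ) (hf : HasCubicExpansion f a₀ a₁ a₂ a₃) :
    HasCubicExpansion (fun z => c * f z) (c * a₀) (fun z => c * a₁ z)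
      (fun z => c * a₂ z) (fun z => c * a₃ z) :=
  ⟨hf.one.const_mul_left c, hf.two.const_mul_left c, hf.three.const_mul_left c,
    (hf.rem.const_mul_left c).congr_left fun z => by ring⟩

theorem sub (hf : HasCubicExpansion f a₀ a₁ a₂ a₃) (hg : HasCubicExpansion g b₀ b₁ b₂ b₃) :
    HasCubicExpansion (fun z => f z - g z) (a₀ - b₀) (fun z => a₁ z - b₁ z)
      (fun z => a₂ z - b₂ z) (fun z => a₃ z - b₃ z) :=
  ⟨hf.one.sub hg.one, hf.two.sub hg.two, hf.three.sub hg.three,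
    (hf.rem.sub hg.rem).congr_left fun z => by ring⟩

theorem mul (hf : HasCubicExpansion f a₀ a₁ a₂ a₃) (hg : HasCubicExpansion g b₀ b₁ b₂ b₃) :
    HasCubicExpansion (fun z => f z * g z) (a₀ * b₀) (fun z => a₀ * b₁ z + a₁ z * b₀)
      (fun z => a₀ * b₂ z + a₁ z * b₁ z + a₂ z * b₀)
      (fun z => a₀ * b₃ z + a₁ z * b₂ z + a₂ z * b₁ z + a₃ z * b₀) := by
  have ca := const_isBigO_norm_pow_zero a₀
  have cb := const_isBigO_norm_pow_zero b₀
  refine ⟨?_, ?_, ?_, ?_⟩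
  · exact (isBigO_mul_norm_pow ca hg.one le_rfl).add (isBigO_mul_norm_pow hf.one cb le_rfl)
  · exact ((isBigO_mul_norm_pow ca hg.two le_rfl).add
      (isBigO_mul_norm_pow hf.one hg.one le_rfl)).add (isBigO_mul_norm_pow hf.two cb le_rfl)
  · exact (((isBigO_mul_norm_pow ca hg.three le_rfl).add
      (isBigO_mul_norm_pow hf.one hg.two le_rfl)).add
      (isBigO_mul_norm_pow hf.two hg.one le_rfl)).add (isBigO_mul_norm_pow hf.three cb le_rfl)
  -- With `F`, `G` the truncations, `fg - FG = (f - F)g + F(g - G)`; the products in `FG` of total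
  -- order at least 4 also go into the remainder.
  · have hF : (fun z => a₀ + a₁ z + a₂ z + a₃ z) =O[𝓝 0] fun z : ℂ => ‖z‖ ^ 0 :=
      ((ca.add (hf.one.trans (norm_pow_isBigO (by norm_num)))).add
        (hf.two.trans (norm_pow_isBigO (by norm_num)))).add
        (hf.three.trans (norm_pow_isBigO (by norm_num)))
    have hg0 : g =O[𝓝 0] fun z : ℂ => ‖z‖ ^ 0 := by
      have := (hg.rem.trans (norm_pow_isBigO (show 0 ≤ 4 by norm_num))).add
        (((cb.add (hg.one.trans (norm_pow_isBigO (by norm_num)))).add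
        (hg.two.trans (norm_pow_isBigO (by norm_num)))).add
        (hg.three.trans (norm_pow_isBigO (by norm_num))))
      simpa using this
    have h1 := isBigO_mul_norm_pow (k := 4) hf.rem hg0 le_rfl
    have h2 := isBigO_mul_norm_pow (k := 4) hF hg.rem le_rfl
    have h3 := (isBigO_mul_norm_pow (k := 4) hf.one hg.three le_rfl).add
      ((isBigO_mul_norm_pow (k := 4) hf.two hg.two le_rfl).add
      (isBigO_mul_norm_pow (k := 4) hf.three hg.one le_rfl))
    have h4 := (isBigO_mul_norm_pow (k := 4) hf.two hg.three (by norm_num)).add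
      ((isBigO_mul_norm_pow (k := 4) hf.three hg.two (by norm_num)).add
      (isBigO_mul_norm_pow (k := 4) hf.three hg.three (by norm_num)))
    refine ((h1.add h2).add (h3.add h4)).congr_left fun z => ?_
    ring

theorem isBigO_one (hf : HasCubicExpansion f 0 a₁ a₂ a₃) : f =O[𝓝 0] fun z : ℂ => ‖z‖ := by
  have := (((hf.rem.trans (norm_pow_isBigO (show 1 ≤ 4 by norm_num))).add hf.one).add
    (hf.two.trans (norm_pow_isBigO (show 1 ≤ 2 by norm_num)))).add
    (hf.three.trans (norm_pow_isBigO (show 1 ≤ 3 by norm_num)))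
  exact this.congr (fun z => by ring) fun z => pow_one _

theorem tendsto_zero (hf : HasCubicExpansion f 0 a₁ a₂ a₃) : Filter.Tendsto f (𝓝 0) (𝓝 0) :=
  hf.isBigO_one.trans_tendsto (by simpa using (continuous_norm (E := ℂ)).tendsto 0)

theorem of_remainder (hf : HasCubicExpansion f a₀ a₁ a₂ a₃)
    (h : (fun z => g z - f z) =O[𝓝 0] fun z => ‖z‖ ^ 4) :
    HasCubicExpansion g a₀ a₁ a₂ a₃ :=
  ⟨hf.one, hf.two, hf.three, (h.add hf.rem).congr_left fun z => by ring⟩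

theorem isBigO_of_eq_zero (hf : HasCubicExpansion f a₀ a₁ a₂ a₃) (h₀ : a₀ = 0)
    (h₁ : ∀ z, a₁ z = 0) (h₂ : ∀ z, a₂ z = 0) (h₃ : ∀ z, a₃ z = 0) :
    f =O[𝓝 0] fun z => ‖z‖ ^ 4 :=
  hf.rem.congr_left fun z => by rw [h₀, h₁, h₂, h₃]; ring

/-- Composition with a function of one variable. -/
theorem comp {φ : ℝ → ℝ} {p₀ p₁ p₂ p₃ : ℝ} (hf : HasCubicExpansion f 0 a₁ a₂ a₃)
    (hφ : (fun x => φ x - (p₀ + p₁ * x + p₂ * x ^ 2 + p₃ * x ^ 3)) =O[𝓝 0] fun x => x ^ 4) :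
    HasCubicExpansion (fun z => φ (f z)) p₀ (fun z => p₁ * a₁ z)
      (fun z => p₁ * a₂ z + p₂ * a₁ z ^ 2)
      (fun z => p₁ * a₃ z + 2 * p₂ * (a₁ z * a₂ z) + p₃ * a₁ z ^ 3) := by
  have h := (((const p₀).add (hf.const_mul p₁)).add ((hf.mul hf).const_mul p₂)).add
    (((hf.mul hf).mul hf).const_mul p₃)
  refine (h.of_remainder (g := fun z => φ (f z)) ?_).congr (by ring) (fun z => by ring)
    (fun z => by ring) (fun z => by ring)
  refine ((hφ.comp_tendsto hf.tendsto_zero).trans (hf.isBigO_one.pow 4)).congr_left fun z => ?_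
  simp only [Function.comp_apply]; ring

end HasCubicExpansion

/-! ### Expansion of the trial orbit. -/

theorem re_const_mul_isBigO (E : ℂ) : (fun w : ℂ => (E * w).re) =O[𝓝 0] fun w => ‖w‖ ^ 1 := by
  refine Asymptotics.IsBigO.of_bound ‖E‖ (Filter.Eventually.of_forall fun w => ?_)
  rw [pow_one, norm_norm, ← norm_mul]
  exact Complex.abs_re_le_norm _

theorem re_const_mul_cube_isBigO (E : ℂ) :
    (fun w : ℂ => (E * ((‖w‖ : ℂ) ^ 2 * w)).re) =O[𝓝 0] fun w => ‖w‖ ^ 3 := by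
  refine Asymptotics.IsBigO.of_bound ‖E‖ (Filter.Eventually.of_forall fun w => ?_)
  have : ‖w‖ ^ 3 = ‖(‖w‖ : ℂ) ^ 2 * w‖ := by simp; ring
  rw [norm_pow, norm_norm, this, ← norm_mul]
  exact Complex.abs_re_le_norm _

/-- The factor `d` serves to read off the real part (`d = 1`) and the imaginary part (`d = -i`). -/
theorem twistMap_re_mul_expansion (d : ℂ) (θ τ : ℝ) :
    HasCubicExpansion (fun w => (d * twistMap θ τ w).re) 0
      (fun w => (d * Complex.exp (Complex.I * θ) * w).re) (fun _ => 0)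
      (fun w => (d * Complex.exp (Complex.I * θ) * (Complex.I * τ) *
        ((‖w‖ : ℂ) ^ 2 * w)).re) := by
  refine ⟨re_const_mul_isBigO _, Asymptotics.isBigO_zero _ _, re_const_mul_cube_isBigO _, ?_⟩
  have h := ((twistMap_sub_isBigO θ τ).const_mul_left d).trans
    (norm_pow_isBigO (show 4 ≤ 5 by norm_num))
  refine (Asymptotics.IsBigO.of_norm_le fun w => ?_).trans h.norm_left
  refine le_trans (le_of_eq ?_) (Complex.abs_re_le_norm _)
  have e : d * (twistMap θ τ w - Complex.exp (Complex.I * θ) *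
      (w + Complex.I * τ * ((‖w‖ : ℂ) ^ 2 * w)))
      = d * twistMap θ τ w - d * Complex.exp (Complex.I * θ) * w
        - d * Complex.exp (Complex.I * θ) * (Complex.I * τ) * ((‖w‖ : ℂ) ^ 2 * w) := by ring
  rw [Real.norm_eq_abs, e, Complex.sub_re, Complex.sub_re]
  congr 1
  ring

theorem norm_sq_expansion :
    HasCubicExpansion (fun w => ‖w‖ ^ 2) 0 (fun _ => 0) (fun w => w.re ^ 2 + w.im ^ 2)
      (fun _ => 0) := by
  have h : ∀ w : ℂ, w.re ^ 2 + w.im ^ 2 = ‖w‖ ^ 2 := fun w => by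
    rw [Complex.sq_norm, Complex.normSq_apply]; ring
  refine ⟨Asymptotics.isBigO_zero _ _, ?_, Asymptotics.isBigO_zero _ _, ?_⟩
  · simp only [h]; exact Asymptotics.isBigO_refl _ _
  · simpa [h] using Asymptotics.isBigO_zero _ _

/-- A real trigonometric polynomial in a complex amplitude. -/
noncomputable def orbitPosition (q₁ q₂ p c₁ c₂ : ℝ) (w : ℂ) : ℝ :=
  2 * w.re + 2 * (q₁ * (w.re * w.re - w.im * w.im) - 2 * q₂ * (w.re * w.im)) + p * ‖w‖ ^ 2
    + 2 * (c₁ * (w.re * w.re * w.re - 3 * (w.re * (w.im * w.im)))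
      - c₂ * (3 * (w.re * w.re * w.im) - w.im * w.im * w.im))

/-- Applied with `ψ = -θ, 0, θ`, this expands three consecutive points of the trial orbit. -/
theorem orbitPosition_twistMap_expansion (q₁ q₂ p c₁ c₂ ψ τ : ℝ) :
    HasCubicExpansion (fun w => orbitPosition q₁ q₂ p c₁ c₂ (twistMap ψ τ w)) 0
      (fun w => 2 * (Real.cos ψ * w.re - Real.sin ψ * w.im))
      (fun w => 2 * (q₁ * ((Real.cos ψ * w.re - Real.sin ψ * w.im) ^ 2
          - (Real.sin ψ * w.re + Real.cos ψ * w.im) ^ 2)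
        - 2 * q₂ * ((Real.cos ψ * w.re - Real.sin ψ * w.im)
          * (Real.sin ψ * w.re + Real.cos ψ * w.im))) + p * (w.re ^ 2 + w.im ^ 2))
      (fun w => -(2 * τ * (w.re ^ 2 + w.im ^ 2) * (Real.sin ψ * w.re + Real.cos ψ * w.im))
        + 2 * (c₁ * ((Real.cos ψ * w.re - Real.sin ψ * w.im) ^ 3
          - 3 * ((Real.cos ψ * w.re - Real.sin ψ * w.im)
            * (Real.sin ψ * w.re + Real.cos ψ * w.im) ^ 2))
        - c₂ * (3 * ((Real.cos ψ * w.re - Real.sin ψ * w.im) ^ 2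
            * (Real.sin ψ * w.re + Real.cos ψ * w.im))
          - (Real.sin ψ * w.re + Real.cos ψ * w.im) ^ 3))) := by
  have hE : Complex.exp (Complex.I * ψ) = ⟨Real.cos ψ, Real.sin ψ⟩ := by
    rw [mul_comm]
    apply Complex.ext
    · rw [Complex.exp_ofReal_mul_I_re]
    · rw [Complex.exp_ofReal_mul_I_im]
  have hM : ∀ w : ℂ, ((‖w‖ : ℂ) ^ 2) = ((w.re ^ 2 + w.im ^ 2 : ℝ) : ℂ) := fun w => by
    rw [← Complex.ofReal_pow, Complex.sq_norm, Complex.normSq_apply]; congr 1; ring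
  have hre : HasCubicExpansion (fun w => (twistMap ψ τ w).re) 0
      (fun w => Real.cos ψ * w.re - Real.sin ψ * w.im) (fun _ => 0)
      (fun w => -(τ * (w.re ^ 2 + w.im ^ 2) * (Real.sin ψ * w.re + Real.cos ψ * w.im))) := by
    have := twistMap_re_mul_expansion 1 ψ τ
    simp only [one_mul] at this
    refine this.congr rfl (fun w => ?_) (fun w => rfl) (fun w => ?_)
    · rw [hE]; simp
    · rw [hE, hM]
      simp only [Complex.mul_re, Complex.mul_im, Complex.I_re, Complex.I_im, Complex.ofReal_re,
        Complex.ofReal_im]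
      ring
  have him : HasCubicExpansion (fun w => (twistMap ψ τ w).im) 0
      (fun w => Real.sin ψ * w.re + Real.cos ψ * w.im) (fun _ => 0)
      (fun w => τ * (w.re ^ 2 + w.im ^ 2) * (Real.cos ψ * w.re - Real.sin ψ * w.im)) := by
    have := twistMap_re_mul_expansion (-Complex.I) ψ τ
    have e : (fun w => (-Complex.I * twistMap ψ τ w).re) = fun w => (twistMap ψ τ w).im := by
      funext w; simp
    rw [e] at this
    refine this.congr rfl (fun w => ?_) (fun w => rfl) (fun w => ?_)
    · rw [hE]; simp; ring
    · rw [hE, hM]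
      simp only [Complex.mul_re, Complex.mul_im, Complex.I_re, Complex.I_im, Complex.ofReal_re,
        Complex.ofReal_im, Complex.neg_re, Complex.neg_im]
      ring
  have hn : HasCubicExpansion (fun w => ‖twistMap ψ τ w‖ ^ 2) 0 (fun _ => 0)
      (fun w => w.re ^ 2 + w.im ^ 2) (fun _ => 0) := by
    simp only [norm_twistMap]; exact norm_sq_expansion
  have h2 := (((hre.mul hre).sub (him.mul him)).const_mul q₁).sub
    ((hre.mul him).const_mul (2 * q₂))
  have h3 := ((((hre.mul hre).mul hre).sub ((hre.mul (him.mul him)).const_mul 3)).const_mul c₁).sub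
    (((((hre.mul hre).mul him).const_mul 3).sub ((him.mul him).mul him)).const_mul c₂)
  have h := (((hre.const_mul 2).add (h2.const_mul 2)).add (hn.const_mul p)).add (h3.const_mul 2)
  exact h.congr (by ring) (fun w => by ring) (fun w => by ring) (fun w => by ring)

/-! ### The reflection law at order three. -/

/-- The polynomial equations for the coefficients of a normal form parametrization, in terms of
`K = cos θ`, `S = sin θ`, the cotangent `ct` of the bouncing angle and the `2`-jet `(1, a, b)` of
the normalized radius of curvature. -/
structure OrbitCoefficients (K S ct a b q h p c e t : ℝ) : Prop where
  eq20r : q * (K - 1) * (2 * K + 1) + K ^ 2 * a = 0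
  eq20i : h * (K + 1) * (2 * K + 1) + K * ct = 0
  eq11 : (1 - K) * p + 2 * a = 0
  eq21r : -1 + b + 2 * a * p + 2 * a * q - 2 * ct * h + 2 * ct ^ 2 - 2 * S * t + 2 * K * b + 4 * K *
      a * p + 4 * K * a * q - 6 * K * ct * h - 8 * K * ct ^ 2 - 2 * K * S * t + K ^ 2 + K
      ^ 2 * b + 2 * K ^ 2 * a * p + 2 * K ^ 2 * a * q + 10 * K ^ 2 * ct * h + 10 * K ^ 2 *
      ct ^ 2 + 6 * K ^ 3 * ct * h - 4 * K ^ 3 * ct ^ 2 - 8 * K ^ 4 * ct * h = 0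
  eq21i : 2 * a * h + 2 * ct * p + 2 * ct * q + 4 * ct * a + 4 * K * a * h - 2 * K * ct * p + 6 * K
      * ct * q + 2 * K * ct * a + 2 * K ^ 2 * a * h - 8 * K ^ 2 * ct * q - 4 * K ^ 2 * ct
      * a = 0
  eq30r : 1 + (1/3) * b + 2 * a * q + 2 * ct * h + 2 * ct ^ 2 - (8/3) * K - 8 * K * c - (2/3) * K *
      b - 4 * K * a * q + 6 * K * ct * h - 4 * K * ct ^ 2 + (1/3) * K ^ 2 - 8 * K ^ 2 * c
      - K ^ 2 * b - 6 * K ^ 2 * a * q - 2 * K ^ 2 * ct * h + 2 * K ^ 2 * ct ^ 2 + (8/3) *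
      K ^ 3 + 8 * K ^ 3 * c + (4/3) * K ^ 3 * b + 8 * K ^ 3 * a * q - 14 * K ^ 3 * ct * h
      - (4/3) * K ^ 4 + 8 * K ^ 4 * c + (4/3) * K ^ 4 * b + 8 * K ^ 4 * a * q + 8 * K ^ 5
      * ct * h = 0
  eq30i : 2 * a * h - 2 * ct * q + (4/3) * ct * a - 8 * K * e - 4 * K * a * h - 6 * K * ct * q -
      (2/3) * K * ct * a - 8 * K ^ 2 * e - 6 * K ^ 2 * a * h - (4/3) * K ^ 2 * ct * a + 8
      * K ^ 3 * e + 8 * K ^ 3 * a * h + 8 * K ^ 3 * ct * q + (8/3) * K ^ 3 * ct * a + 8 *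
      K ^ 4 * e + 8 * K ^ 4 * a * h = 0

section

variable {k s K S ct a b q h p c e t : ℝ}

/-- Real part of a chord `e^{iα} N(y) - e^{-iα} N(x)`, where `k = cos α`, `s = sin α`. -/
def chordRe (k s : ℝ) (Nr Ni : ℝ → ℝ) (x y : ℝ) : ℝ := k * (Nr y - Nr x) - s * (Ni y + Ni x)

/-- Imaginary part of a chord `e^{iα} N(y) - e^{-iα} N(x)`, where `k = cos α`, `s = sin α`. -/
def chordIm (k s : ℝ) (Nr Ni : ℝ → ℝ) (x y : ℝ) : ℝ := k * (Ni y - Ni x) + s * (Nr y + Nr x)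

/-- Imaginary part of the product of two consecutive chords, in the frame of the tangent at the
common end point; it vanishes when the reflection law holds. -/
noncomputable def reflectionDefect (k s : ℝ) (Nr Ni : ℝ → ℝ) (x y z : ℝ) : ℝ :=
  (chordRe k s Nr Ni x y * chordIm k s Nr Ni y z + chordIm k s Nr Ni x y * chordRe k s Nr Ni y z)
      * Real.cos (2 * y)
    - (chordRe k s Nr Ni x y * chordRe k s Nr Ni y z
      - chordIm k s Nr Ni x y * chordIm k s Nr Ni y z) * Real.sin (2 * y)

theorem cos_two_mul_sub_isBigO :
    (fun x : ℝ => Real.cos (2 * x) - (1 + 0 * x + (-2) * x ^ 2 + 0 * x ^ 3)) =O[𝓝 0]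
      fun x => x ^ 4 := by
  refine Asymptotics.IsBigO.of_bound (16 * (5 / 96)) ?_
  filter_upwards [Metric.ball_mem_nhds (0 : ℝ) (show (0 : ℝ) < 1 / 2 by norm_num)] with x hx
  rw [mem_ball_zero_iff, Real.norm_eq_abs] at hx
  have h1 : |2 * x| ≤ 1 := by rw [abs_mul, abs_two]; linarith
  have h2 := Real.cos_bound h1
  rw [Real.norm_eq_abs, Real.norm_eq_abs, abs_pow]
  rw [abs_mul, abs_two] at h2
  calc _ = |Real.cos (2 * x) - (1 - (2 * x) ^ 2 / 2)| := by congr 1; ring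
    _ ≤ _ := h2
    _ = _ := by ring

theorem sin_two_mul_sub_isBigO :
    (fun x : ℝ => Real.sin (2 * x) - (0 + 2 * x + 0 * x ^ 2 + (-4 / 3) * x ^ 3)) =O[𝓝 0]
      fun x => x ^ 4 := by
  refine Asymptotics.IsBigO.of_bound 1 ?_
  filter_upwards [Metric.ball_mem_nhds (0 : ℝ) (show (0 : ℝ) < 1 / 2 by norm_num)] with x hx
  rw [mem_ball_zero_iff, Real.norm_eq_abs] at hx
  have h1 : |2 * x| ≤ 1 := by rw [abs_mul, abs_two]; linarith
  have h2 := Real.sin_bound h1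
  rw [Real.norm_eq_abs, Real.norm_eq_abs, abs_pow]
  rw [abs_mul, abs_two] at h2
  calc _ = |Real.sin (2 * x) - (2 * x - (2 * x) ^ 3 / 6)| := by congr 1; ring
    _ ≤ _ := h2
    _ = 8 / 25 * |x| ^ 4 * |x| := by ring
    _ ≤ 8 / 25 * |x| ^ 4 * (1 / 2) := by gcongr
    _ ≤ _ := by nlinarith [pow_nonneg (abs_nonneg x) 4]

/-- The points are the previous, present and next one of the trial orbit. The defect is quadratic in
`(k, s)`, so with `k = ct * s` a factor `s²` comes out. Order one cancels by the choice of `θ`. The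
equations `eq20`, `eq11`, `eq21`, `eq30` kill the coefficients of `w²`, `|w|²`, `|w|²w` and `w³`,
the suffixes `r` and `i` standing for real and imaginary parts. The factors `sin θ` in the imaginary
coefficients of the trial orbit keep `sin θ` out of these equations, apart from the term in `S * t`.
-/
theorem reflectionDefect_isBigO {Nr Ni : ℝ → ℝ} {θ : ℝ}
    (hNr : (fun x => Nr x - (0 + 1 * x + (a / 2) * x ^ 2 + ((b - 1) / 6) * x ^ 3)) =O[𝓝 0]
      fun x => x ^ 4)
    (hNi : (fun x => Ni x - (-((1 + Real.cos θ) / 2) + 0 * x + (1 / 2) * x ^ 2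
      + (a / 3) * x ^ 3)) =O[𝓝 0] fun x => x ^ 4)
    (hk : k = ct * s)
    (hc : OrbitCoefficients (Real.cos θ) (Real.sin θ) ct a b q h p c e t) :
    (fun w => reflectionDefect k s Nr Ni
      (orbitPosition q (Real.sin θ * h) p c (Real.sin θ * e) (twistMap (-θ) (-t) w))
      (orbitPosition q (Real.sin θ * h) p c (Real.sin θ * e) (twistMap 0 0 w))
      (orbitPosition q (Real.sin θ * h) p c (Real.sin θ * e) (twistMap θ t w)))
      =O[𝓝 0] fun w => ‖w‖ ^ 4 := by
  have x0 := orbitPosition_twistMap_expansion q (Real.sin θ * h) p c (Real.sin θ * e) (-θ) (-t)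
  have x1 := orbitPosition_twistMap_expansion q (Real.sin θ * h) p c (Real.sin θ * e) 0 0
  have x2 := orbitPosition_twistMap_expansion q (Real.sin θ * h) p c (Real.sin θ * e) θ t
  have hS : Real.sin θ ^ 2 - (1 - Real.cos θ ^ 2) = 0 := by
    linarith [Real.sin_sq_add_cos_sq θ]
  have hRe {f g : ℂ → ℝ} {f₁ f₂ f₃ g₁ g₂ g₃ : ℂ → ℝ} (hf : HasCubicExpansion f 0 f₁ f₂ f₃)
      (hg : HasCubicExpansion g 0 g₁ g₂ g₃) :=
    (((hg.comp hNr).sub (hf.comp hNr)).const_mul k).sub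
      (((hg.comp hNi).add (hf.comp hNi)).const_mul s)
  have hIm {f g : ℂ → ℝ} {f₁ f₂ f₃ g₁ g₂ g₃ : ℂ → ℝ} (hf : HasCubicExpansion f 0 f₁ f₂ f₃)
      (hg : HasCubicExpansion g 0 g₁ g₂ g₃) :=
    (((hg.comp hNi).sub (hf.comp hNi)).const_mul k).add
      (((hg.comp hNr).add (hf.comp hNr)).const_mul s)
  have hR := (((((hRe x0 x1).mul (hIm x1 x2)).add ((hIm x0 x1).mul (hRe x1 x2))).mul
    (x1.comp cos_two_mul_sub_isBigO)).sub
    ((((hRe x0 x1).mul (hRe x1 x2)).sub ((hIm x0 x1).mul (hIm x1 x2))).mul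
      (x1.comp sin_two_mul_sub_isBigO)))
  have h20r := hc.eq20r
  have h20i := hc.eq20i
  have h11 := hc.eq11
  have h21r := hc.eq21r
  have h21i := hc.eq21i
  have h30r := hc.eq30r
  have h30i := hc.eq30i
  refine hR.isBigO_of_eq_zero (by ring) (fun w => ?_) (fun w => ?_) (fun w => ?_)
  all_goals
    clear hR hRe hIm x0 x1 x2 hc hNr hNi
    subst hk
    rw [Real.cos_neg, Real.sin_neg, Real.cos_zero, Real.sin_zero]
    generalize w.re = u
    generalize w.im = v
    revert hS h20r h20i h11 h21r h21i h30r h30i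
    generalize Real.cos θ = K
    generalize Real.sin θ = S
    intro hS h20r h20i h11 h21r h21i h30r h30i
  · ring
  -- The multipliers are the real and imaginary parts of the monomials in `w`; the last bracket
  -- collects the multiples of `S² + K² = 1`.
  · linear_combination (2 * (K + 1)) * (s ^ 2 * (2 * u ^ 2 - 2 * v ^ 2)) * h20r
      + 2 * (1 + K) * (s ^ 2 * (u ^ 2 + v ^ 2)) * h11
      + 8 * (1 - K) * (s ^ 2 * u * v * S) * h20i
      + (4 * v ^ 2 * s ^ 2 * q + 4 * v ^ 2 * s ^ 2 * a + 4 * v ^ 2 * K * s ^ 2 * q + 4 * v ^ 2 *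
        K * s ^ 2 * a + 8 * u * v * S * s ^ 2 * h + 8 * u * v * K * S * s ^ 2 * h - 4 *
        u ^ 2 * s ^ 2 * q - 4 * u ^ 2 * K * s ^ 2 * q) * hS
  · linear_combination (s ^ 2 * (2 * u ^ 3 - 6 * u * v ^ 2)) * h30r
      + (s ^ 2 * (2 * u ^ 3 + 2 * u * v ^ 2)) * h21r
      + (s ^ 2 * S * (2 * v ^ 3 - 6 * u ^ 2 * v)) * h30i
      - (s ^ 2 * S * (2 * v ^ 3 + 2 * u ^ 2 * v)) * h21i
      + ((-8) * v ^ 3 * S * s ^ 2 * ct * q - (16/3) * v ^ 3 * S * s ^ 2 * ct * a - (12) * v ^ 3 *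
        K * S * s ^ 2 * e - (16) * v ^ 3 * K * S * s ^ 2 * a * h - 8 * v ^ 3 * K * S * s
        ^ 2 * ct * q - (16/3) * v ^ 3 * K * S * s ^ 2 * ct * a - (12) * v ^ 3 * K ^ 2 *
        S * s ^ 2 * e - (16) * v ^ 3 * K ^ 2 * S * s ^ 2 * a * h - 8 * u * v ^ 2 * s ^ 2
        - (16) * u * v ^ 2 * s ^ 2 * ct * h - 8 * u * v ^ 2 * s ^ 2 * ct ^ 2 - (16) * u
        * v ^ 2 * S ^ 2 * s ^ 2 * ct * h + (16) * u * v ^ 2 * K * s ^ 2 + (36) * u * v ^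
        2 * K * s ^ 2 * c + 8 * u * v ^ 2 * K * s ^ 2 * b + (40) * u * v ^ 2 * K * s ^ 2
        * a * q - (48) * u * v ^ 2 * K * s ^ 2 * ct * h + 8 * u * v ^ 2 * K * s ^ 2 * ct
        ^ 2 - (16) * u * v ^ 2 * K * S ^ 2 * s ^ 2 * ct * h - 8 * u * v ^ 2 * K ^ 2 * s
        ^ 2 + (36) * u * v ^ 2 * K ^ 2 * s ^ 2 * c + 8 * u * v ^ 2 * K ^ 2 * s ^ 2 * b +
        (40) * u * v ^ 2 * K ^ 2 * s ^ 2 * a * q + (16) * u * v ^ 2 * K ^ 2 * s ^ 2 * ct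
        * h + (48) * u * v ^ 2 * K ^ 3 * s ^ 2 * ct * h + 8 * u ^ 2 * v * S * s ^ 2 * ct
        * q + (36) * u ^ 2 * v * K * S * s ^ 2 * e + (32) * u ^ 2 * v * K * S * s ^ 2 *
        a * h + 8 * u ^ 2 * v * K * S * s ^ 2 * ct * q + (36) * u ^ 2 * v * K ^ 2 * S *
        s ^ 2 * e + (32) * u ^ 2 * v * K ^ 2 * S * s ^ 2 * a * h - (12) * u ^ 3 * K * s
        ^ 2 * c - 8 * u ^ 3 * K * s ^ 2 * a * q - (12) * u ^ 3 * K ^ 2 * s ^ 2 * c - 8 *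
        u ^ 3 * K ^ 2 * s ^ 2 * a * q + (16) * u ^ 3 * K ^ 2 * s ^ 2 * ct * h - (16) * u
        ^ 3 * K ^ 3 * s ^ 2 * ct * h) * hS

end

/-- The system is triangular: `q`, `h`, `p` come from order two, then `t`, `c`, `e` from order
three. Since `q`, `p` do not involve `ct` and `h` is linear in it, `t` is affine in `ct²`. -/
theorem exists_orbitCoefficients {K S : ℝ} (hS : S ≠ 0) (h1 : 1 - K ≠ 0) (h2 : K + 1 ≠ 0)
    (h3 : K ≠ 0) (h4 : 2 * K + 1 ≠ 0) (a b : ℝ) :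
    ∃ A B : ℝ, B ≠ 0 ∧ ∀ ct : ℝ, ∃ q h p c e : ℝ,
      OrbitCoefficients K S ct a b q h p c e (A + B * ct ^ 2) := by
  have hK : K - 1 ≠ 0 := fun h => h1 (by linarith)
  set q : ℝ := -(K ^ 2 * a) / ((K - 1) * (2 * K + 1)) with hq
  set p : ℝ := -(2 * a) / (1 - K) with hp
  -- These values come from solving `eq21r` for `t`, whose coefficient is `-2S(K + 1)`, once `h` is
  -- substituted.
  refine ⟨(K ^ 2 - 1 + (K + 1) ^ 2 * b + 2 * (K + 1) ^ 2 * a * (p + q)) / (2 * S * (K + 1)),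
    (K - 1) ^ 2 / (S * (2 * K + 1)), by positivity, fun ct => ?_⟩
  set h : ℝ := -(K * ct) / ((K + 1) * (2 * K + 1)) with hh
  have e20r : q * (K - 1) * (2 * K + 1) + K ^ 2 * a = 0 := by
    rw [hq, mul_assoc, div_mul_cancel₀ _ (mul_ne_zero hK h4)]; ring
  have e20i : h * (K + 1) * (2 * K + 1) + K * ct = 0 := by
    rw [hh, mul_assoc, div_mul_cancel₀ _ (mul_ne_zero h2 h4)]; ring
  have e11 : (1 - K) * p + 2 * a = 0 := by rw [hp]; field_simp; ring
  -- The divisor of the third harmonic, proportional to `cos 3θ - cos θ = 4K(K² - 1)`; this is where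
  -- `K ≠ 0` is needed.
  have h8 : 8 * K * (K + 1) ^ 2 * (K - 1) ≠ 0 := by positivity
  obtain ⟨c, hc⟩ : ∃ c : ℝ, 8 * K * (K + 1) ^ 2 * (K - 1) * c = -(1 + (1/3) * b + 2 * a * q
      + 2 * ct * h + 2 * ct ^ 2 - (8/3) * K - (2/3) * K * b - 4 * K * a * q + 6 * K * ct * h
      - 4 * K * ct ^ 2 + (1/3) * K ^ 2 - K ^ 2 * b - 6 * K ^ 2 * a * q - 2 * K ^ 2 * ct * h
      + 2 * K ^ 2 * ct ^ 2 + (8/3) * K ^ 3 + (4/3) * K ^ 3 * b + 8 * K ^ 3 * a * q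
      - 14 * K ^ 3 * ct * h - (4/3) * K ^ 4 + (4/3) * K ^ 4 * b + 8 * K ^ 4 * a * q
      + 8 * K ^ 5 * ct * h) := ⟨_, mul_div_cancel₀ _ h8⟩
  obtain ⟨e, he⟩ : ∃ e : ℝ, 8 * K * (K + 1) ^ 2 * (K - 1) * e = -(2 * a * h - 2 * ct * q
      + (4/3) * ct * a - 4 * K * a * h - 6 * K * ct * q - (2/3) * K * ct * a
      - 6 * K ^ 2 * a * h - (4/3) * K ^ 2 * ct * a + 8 * K ^ 3 * a * h
      + 8 * K ^ 3 * ct * q + (8/3) * K ^ 3 * ct * a + 8 * K ^ 4 * a * h) :=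
    ⟨_, mul_div_cancel₀ _ h8⟩
  refine ⟨q, h, p, c, e, e20r, e20i, e11, ?_, ?_, ?_, ?_⟩
  · rw [hh]; field_simp; ring
  -- No unknown is left for `eq21i`: it holds identically once order two is solved, which is why a
  -- real `t` suffices.
  · rw [hq, hp, hh]; field_simp; ring
  · linear_combination hc
  · linear_combination he

/-! ### Taylor expansions and normalized germs. -/

/-- The mean value inequality on the ball of radius `‖x‖`. It serves to integrate remainder
estimates one order at a time. -/
theorem isBigO_pow_succ_of_hasDerivAt {f f' : ℝ → ℝ} {n : ℕ}
    (hf : ∀ x, HasDerivAt f (f' x) x) (h0 : f 0 = 0) (h : f' =O[𝓝 0] fun x => x ^ n) :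
    f =O[𝓝 0] fun x => x ^ (n + 1) := by
  obtain ⟨C, hC⟩ := h.bound
  obtain ⟨δ, hδ, hb⟩ := Metric.eventually_nhds_iff_ball.1 hC
  refine Asymptotics.IsBigO.of_bound C ?_
  filter_upwards [Metric.ball_mem_nhds (0 : ℝ) hδ] with x hx
  rw [mem_ball_zero_iff] at hx
  have := Convex.norm_image_sub_le_of_norm_hasDerivWithin_le (f := f) (f' := f')
    (s := Metric.closedBall 0 ‖x‖) (C := C * ‖x‖ ^ n) (x := 0) (y := x)
    (fun y _ => (hf y).hasDerivWithinAt) (fun y hy => by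
      rw [mem_closedBall_zero_iff] at hy
      have h1 := hb y (mem_ball_zero_iff.2 (hy.trans_lt hx))
      rw [norm_pow] at h1
      refine h1.trans ?_
      -- The bound comes without a sign for `C`; the sign is recovered from the estimate at `x` when
      -- `x ≠ 0`.
      rcases eq_or_ne C 0 with hC0 | hC0
      · simp [hC0]
      have hC1 : 0 ≤ C * ‖x‖ ^ n ∨ x = 0 := by
        by_cases hx0 : x = 0
        · exact Or.inr hx0
        left
        have h2 := (norm_nonneg _).trans (hb x (mem_ball_zero_iff.2 hx))
        rwa [norm_pow] at h2
      rcases hC1 with h2 | h2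
      · by_cases hx0 : x = 0
        · rw [hx0, norm_zero] at hy
          rw [norm_le_zero_iff.1 hy, hx0]
        have hCn : 0 ≤ C := nonneg_of_mul_nonneg_left h2 (by positivity)
        gcongr
      · rw [h2, norm_zero] at hy
        rw [norm_le_zero_iff.1 hy, h2])
    (convex_closedBall 0 ‖x‖) (by simp) (by simp)
  rw [h0, sub_zero, sub_zero] at this
  rw [norm_pow, pow_succ, ← mul_assoc]
  exact this

theorem quadratic_taylor {ρ : ℝ → ℝ} (hρ : ContDiff ℝ ∞ ρ) :
    (fun x => ρ x - (ρ 0 + deriv ρ 0 * x + deriv (deriv ρ) 0 / 2 * x ^ 2)) =O[𝓝 0]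
      fun x => x ^ 3 := by
  have h1 := contDiff_infty_iff_deriv.1 hρ
  have h2 := contDiff_infty_iff_deriv.1 h1.2
  have h3 := contDiff_infty_iff_deriv.1 h2.2
  have e2 : (fun x => deriv (deriv ρ) x - deriv (deriv ρ) 0) =O[𝓝 0] fun x => x ^ 1 := by
    simpa using (h3.1 0).isBigO_sub
  have e1 : (fun x => deriv ρ x - deriv ρ 0 - deriv (deriv ρ) 0 * x) =O[𝓝 0]
      fun x => x ^ 2 := by
    refine isBigO_pow_succ_of_hasDerivAt (fun x => ?_) (by simp) e2
    have := ((h2.1 x).hasDerivAt.sub_const (deriv ρ 0)).sub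
      ((hasDerivAt_id x).const_mul (deriv (deriv ρ) 0))
    exact this.congr_deriv (by simp)
  refine isBigO_pow_succ_of_hasDerivAt (fun x => ?_) (by simp) e1
  have := (h1.1 x).hasDerivAt.sub ((((hasDerivAt_id x).const_mul (deriv ρ 0)).const_add
    (ρ 0)).add (((hasDerivAt_id x).pow 2).const_mul (deriv (deriv ρ) 0 / 2)))
  refine this.congr_deriv ?_
  simp only [id, Nat.cast_ofNat, mul_one]
  ring

theorem pow_isBigO_pow {m n : ℕ} (h : n ≤ m) :
    (fun x : ℝ => x ^ m) =O[𝓝 0] fun x : ℝ => x ^ n := by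
  rcases h.eq_or_lt with rfl | h
  · exact Asymptotics.isBigO_refl _ _
  · exact (Asymptotics.isLittleO_pow_pow h).isBigO

theorem isBigO_one_of_continuous {f : ℝ → ℝ} (hf : Continuous f) :
    f =O[𝓝 0] fun _ : ℝ => (1 : ℝ) :=
  (hf.tendsto 0).isBigO_one ℝ

theorem cos_sub_isBigO : (fun x : ℝ => Real.cos x - (1 - x ^ 2 / 2)) =O[𝓝 0] fun x => x ^ 3 := by
  have hs : (fun x : ℝ => x - Real.sin x) =O[𝓝 0] fun x => x ^ 2 := by
    refine isBigO_pow_succ_of_hasDerivAt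
      (fun x => (hasDerivAt_id x).sub (Real.hasDerivAt_sin x)) (by simp) ?_
    simpa using (Real.differentiable_cos 0).isBigO_sub.neg_left
  refine isBigO_pow_succ_of_hasDerivAt (fun x => ?_) (by simp) hs
  refine ((Real.hasDerivAt_cos x).sub (((hasDerivAt_id x).pow 2).div_const 2 |>.const_sub
    1)).congr_deriv ?_
  simp only [id, Nat.cast_ofNat, mul_one]
  ring

theorem sin_sub_isBigO : (fun x : ℝ => Real.sin x - x) =O[𝓝 0] fun x => x ^ 3 := by
  refine isBigO_pow_succ_of_hasDerivAt
    (fun x => (Real.hasDerivAt_sin x).sub (hasDerivAt_id x)) (by simp) ?_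
  have h1 := (cos_sub_isBigO.trans (pow_isBigO_pow (show 2 ≤ 3 by norm_num))).sub
    ((Asymptotics.isBigO_refl (fun x : ℝ => x ^ 2) (𝓝 0)).const_mul_left (1 / 2))
  exact h1.congr_left fun x => by ring

/-- A curve germ through the point `-ig`, parametrized by the angle of its tangent, with radius of
curvature `ρ` normalized to be `1` at the base point. -/
structure IsNormalizedGerm (N : ℝ → ℂ) (ρ : ℝ → ℝ) (g : ℝ) : Prop where
  smooth : ContDiff ℝ ∞ ρ
  hasDerivAt : ∀ x : ℝ, HasDerivAt N (ρ x * Complex.exp (Complex.I * x)) x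
  radius : ρ 0 = 1
  base : N 0 = -Complex.I * g
  pos : 0 < g

theorem hasDerivAt_re {N : ℝ → ℂ} {N' : ℂ} {x : ℝ} (h : HasDerivAt N N' x) :
    HasDerivAt (fun y => (N y).re) N'.re x :=
  (Complex.reCLM.hasFDerivAt (x := N x)).comp_hasDerivAt x h

theorem hasDerivAt_im {N : ℝ → ℂ} {N' : ℂ} {x : ℝ} (h : HasDerivAt N N' x) :
    HasDerivAt (fun y => (N y).im) N'.im x :=
  (Complex.imCLM.hasFDerivAt (x := N x)).comp_hasDerivAt x h

theorem exp_I_mul_eq (x : ℝ) : Complex.exp (Complex.I * x) = ⟨Real.cos x, Real.sin x⟩ := by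
  rw [mul_comm]
  apply Complex.ext
  · rw [Complex.exp_ofReal_mul_I_re]
  · rw [Complex.exp_ofReal_mul_I_im]

namespace IsNormalizedGerm

variable {N : ℝ → ℂ} {ρ : ℝ → ℝ} {g : ℝ}

theorem contDiff (h : IsNormalizedGerm N ρ g) : ContDiff ℝ ∞ N := by
  refine contDiff_infty_iff_deriv.2 ⟨fun x => (h.hasDerivAt x).differentiableAt, ?_⟩
  rw [show deriv N = _ from funext fun x => (h.hasDerivAt x).deriv]
  have h1 : ContDiff ℝ ∞ (fun x => (ρ x : ℂ)) := Complex.ofRealCLM.contDiff.comp h.smooth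
  have h2 : ContDiff ℝ ∞ (fun x : ℝ => (x : ℂ)) := Complex.ofRealCLM.contDiff
  exact h1.mul (contDiff_const.mul h2).cexp

theorem re_taylor (h : IsNormalizedGerm N ρ g) :
    (fun x => (N x).re - (0 + 1 * x + (deriv ρ 0 / 2) * x ^ 2
      + ((deriv (deriv ρ) 0 - 1) / 6) * x ^ 3)) =O[𝓝 0] fun x => x ^ 4 := by
  have hρ := quadratic_taylor h.smooth
  rw [h.radius] at hρ
  set a := deriv ρ 0
  set b := deriv (deriv ρ) 0
  refine isBigO_pow_succ_of_hasDerivAt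
    (f' := fun x => ρ x * Real.cos x - (1 + a * x + (b - 1) / 2 * x ^ 2))
    (fun x => ?_) (by simp [h.base]) ?_
  · have h1 := hasDerivAt_re (h.hasDerivAt x)
    have h2 := (((hasDerivAt_id x).const_mul (1 : ℝ)).const_add 0).add
      (((hasDerivAt_id x).pow 2).const_mul (a / 2)) |>.add
      (((hasDerivAt_id x).pow 3).const_mul ((b - 1) / 6))
    refine (h1.sub h2).congr_deriv ?_
    rw [exp_I_mul_eq]
    simp only [Complex.mul_re, Complex.ofReal_re, Complex.ofReal_im, zero_mul, sub_zero, id,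
      Nat.cast_ofNat, mul_one]
    ring
  · have hc : (fun x : ℝ => Real.cos x) =O[𝓝 0] fun _ : ℝ => (1 : ℝ) :=
      isBigO_one_of_continuous Real.continuous_cos
    have hp : (fun x : ℝ => 1 + a * x + b / 2 * x ^ 2) =O[𝓝 0] fun _ : ℝ => (1 : ℝ) :=
      isBigO_one_of_continuous (by fun_prop)
    have hq : (fun x : ℝ => -(a / 2) - b / 4 * x) =O[𝓝 0] fun _ : ℝ => (1 : ℝ) :=
      isBigO_one_of_continuous (by fun_prop)
    have e1 := (hρ.mul hc).add (cos_sub_isBigO.mul hp)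
    have e2 := e1.add ((Asymptotics.isBigO_refl (fun x : ℝ => x ^ 3) (𝓝 0)).mul hq)
    exact e2.congr (fun x => by ring) fun x => by ring

theorem im_taylor (h : IsNormalizedGerm N ρ g) :
    (fun x => (N x).im - (-g + 0 * x + (1 / 2) * x ^ 2
      + (deriv ρ 0 / 3) * x ^ 3)) =O[𝓝 0] fun x => x ^ 4 := by
  have hρ := quadratic_taylor h.smooth
  rw [h.radius] at hρ
  set a := deriv ρ 0
  set b := deriv (deriv ρ) 0
  refine isBigO_pow_succ_of_hasDerivAt
    (f' := fun x => ρ x * Real.sin x - (x + a * x ^ 2)) (fun x => ?_) (by simp [h.base]) ?_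
  · have h1 := hasDerivAt_im (h.hasDerivAt x)
    have h2 := (((hasDerivAt_id x).const_mul (0 : ℝ)).const_add (-g)).add
      (((hasDerivAt_id x).pow 2).const_mul (1 / 2 : ℝ)) |>.add
      (((hasDerivAt_id x).pow 3).const_mul (a / 3))
    refine (h1.sub h2).congr_deriv ?_
    rw [exp_I_mul_eq]
    simp only [Complex.mul_im, Complex.ofReal_re, Complex.ofReal_im, zero_mul, add_zero, id,
      Nat.cast_ofNat, mul_one]
    ring
  · have hc : (fun x : ℝ => Real.sin x) =O[𝓝 0] fun _ : ℝ => (1 : ℝ) :=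
      isBigO_one_of_continuous Real.continuous_sin
    have hp : (fun x : ℝ => 1 + a * x + b / 2 * x ^ 2) =O[𝓝 0] fun _ : ℝ => (1 : ℝ) :=
      isBigO_one_of_continuous (by fun_prop)
    have e1 := (hρ.mul hc).add (sin_sub_isBigO.mul hp)
    have e2 := e1.add ((Asymptotics.isBigO_refl (fun x : ℝ => x ^ 3 * 1) (𝓝 0)).const_mul_left
      (b / 2))
    exact e2.congr (fun x => by ring) fun x => by ring

end IsNormalizedGerm

/-! ### Chords and momenta of a germ. -/

/-- The chord `e^{iα} N(y) - e^{-iα} N(x)` between the rotated copies of a germ. -/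
noncomputable def germChord (α : ℝ) (N : ℝ → ℂ) (x y : ℝ) : ℂ :=
  Complex.exp (Complex.I * α) * N y - Complex.exp (Complex.I * ((-α : ℝ) : ℂ)) * N x

/-- Cosine of the angle between the chord and the tangent at its starting point. -/
noncomputable def outMomentum (α : ℝ) (N : ℝ → ℂ) (x y : ℝ) : ℝ :=
  Real.cos (α - x + (Complex.log (germChord α N x y)).im)

/-- Cosine of the angle between the chord and the tangent at its end point. -/
noncomputable def inMomentum (α : ℝ) (N : ℝ → ℂ) (x y : ℝ) : ℝ :=
  Real.cos ((Complex.log (germChord α N x y)).im - α - y)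

theorem germChord_re (α : ℝ) (N : ℝ → ℂ) (x y : ℝ) : (germChord α N x y).re
    = chordRe (Real.cos α) (Real.sin α) (fun x => (N x).re) (fun x => (N x).im) x y := by
  rw [germChord, exp_I_mul_eq, exp_I_mul_eq, chordRe]
  simp; ring

theorem germChord_im (α : ℝ) (N : ℝ → ℂ) (x y : ℝ) : (germChord α N x y).im
    = chordIm (Real.cos α) (Real.sin α) (fun x => (N x).re) (fun x => (N x).im) x y := by
  rw [germChord, exp_I_mul_eq, exp_I_mul_eq, chordIm]
  simp; ring

namespace IsNormalizedGerm

variable {N : ℝ → ℂ} {ρ : ℝ → ℝ} {g α : ℝ}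

/-- The base chord is a positive real when `sin α > 0`, so near it `Complex.log` is smooth and its
imaginary part is a direction angle close to 0. -/
theorem germChord_zero (h : IsNormalizedGerm N ρ g) (α : ℝ) :
    germChord α N 0 0 = ((2 * g * Real.sin α : ℝ) : ℂ) := by
  rw [germChord, exp_I_mul_eq, exp_I_mul_eq, h.base]
  apply Complex.ext
  · simp [-Complex.ofReal_sin, -Complex.ofReal_cos]; ring
  · simp [-Complex.ofReal_sin, -Complex.ofReal_cos]

theorem tendsto_germChord (h : IsNormalizedGerm N ρ g) (α : ℝ) :
    Filter.Tendsto (fun v : ℝ × ℝ => germChord α N v.1 v.2) (𝓝 0)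
      (𝓝 ((2 * g * Real.sin α : ℝ) : ℂ)) := by
  have hc := h.contDiff.continuous
  have : Continuous (fun v : ℝ × ℝ => germChord α N v.1 v.2) := by
    unfold germChord; fun_prop
  rw [← h.germChord_zero α]
  exact this.tendsto 0

theorem base_mem_slitPlane (h : IsNormalizedGerm N ρ g) (hα : 0 < Real.sin α) :
    ((2 * g * Real.sin α : ℝ) : ℂ) ∈ Complex.slitPlane :=
  Complex.ofReal_mem_slitPlane.2 (by have := h.pos; positivity)

theorem eventually_germChord (h : IsNormalizedGerm N ρ g) (hα : 0 < Real.sin α) :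
    ∀ᶠ v : ℝ × ℝ in 𝓝 0, germChord α N v.1 v.2 ∈ Complex.slitPlane ∧
      g * Real.sin α < ‖germChord α N v.1 v.2‖ := by
  have hp : 0 < g * Real.sin α := mul_pos h.pos hα
  refine ((h.tendsto_germChord α).eventually
    (Complex.isOpen_slitPlane.mem_nhds (h.base_mem_slitPlane hα))).and
    ((h.tendsto_germChord α).norm.eventually (lt_mem_nhds ?_))
  rw [Complex.norm_real, Real.norm_eq_abs, abs_of_pos (by linarith)]
  linarith

theorem tendsto_log_germChord (h : IsNormalizedGerm N ρ g) (hα : 0 < Real.sin α) :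
    Filter.Tendsto (fun v : ℝ × ℝ => (Complex.log (germChord α N v.1 v.2)).im) (𝓝 0) (𝓝 0) := by
  have h1 := ((continuousAt_clog (h.base_mem_slitPlane hα)).tendsto.comp
    (h.tendsto_germChord α))
  have h2 := (Complex.continuous_im.tendsto _).comp h1
  rwa [Complex.log_im, Complex.arg_ofReal_of_nonneg (by have := h.pos; positivity)] at h2

theorem contDiffAt_outMomentum {E : Type*} [NormedAddCommGroup E] [NormedSpace ℝ E]
    (h : IsNormalizedGerm N ρ g) {x y : E → ℝ} {z : E} (hx : ContDiffAt ℝ ∞ x z)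
    (hy : ContDiffAt ℝ ∞ y z) (hz : germChord α N (x z) (y z) ∈ Complex.slitPlane) :
    ContDiffAt ℝ ∞ (fun z => outMomentum α N (x z) (y z)) z := by
  have hNx : ContDiffAt ℝ ∞ (fun z => N (x z)) z := h.contDiff.contDiffAt.comp z hx
  have hNy : ContDiffAt ℝ ∞ (fun z => N (y z)) z := h.contDiff.contDiffAt.comp z hy
  have h1 : ContDiffAt ℝ ∞ (fun z => germChord α N (x z) (y z)) z :=
    (contDiffAt_const.mul hNy).sub (contDiffAt_const.mul hNx)
  have h2 : ContDiffAt ℝ ∞ (fun z => Complex.log (germChord α N (x z) (y z))) z :=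
    ContDiffAt.comp (g := Complex.log) z ((Complex.contDiffAt_log hz).restrict_scalars ℝ) h1
  have h3 : ContDiffAt ℝ ∞ (fun z => (Complex.log (germChord α N (x z) (y z))).im) z :=
    (Complex.imCLM.contDiff.contDiffAt).comp z h2
  exact ((contDiffAt_const.sub hx).add h3).cos

/-- Derivative of the direction of the chord along a motion of its end points. -/
theorem hasDerivAt_log_germChord (h : IsNormalizedGerm N ρ g) (hα : 0 < Real.sin α)
    {x y : ℝ → ℝ} {x' y' : ℝ} (hx : HasDerivAt x x' 0) (hy : HasDerivAt y y' 0)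
    (hx0 : x 0 = 0) (hy0 : y 0 = 0) :
    HasDerivAt (fun t => (Complex.log (germChord α N (x t) (y t))).im)
      ((x' + y') / (2 * g)) 0 := by
  have hN : HasDerivAt N 1 0 := by
    have := h.hasDerivAt 0
    simpa [h.radius] using this
  have hNx : HasDerivAt (fun t => N (x t)) (x' • (1 : ℂ)) 0 :=
    HasDerivAt.scomp 0 (by rwa [hx0]) hx
  have hNy : HasDerivAt (fun t => N (y t)) (y' • (1 : ℂ)) 0 :=
    HasDerivAt.scomp 0 (by rwa [hy0]) hy
  have hc := (hNy.const_mul (Complex.exp (Complex.I * α))).sub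
    (hNx.const_mul (Complex.exp (Complex.I * ((-α : ℝ) : ℂ))))
  have hb : germChord α N (x 0) (y 0) = ((2 * g * Real.sin α : ℝ) : ℂ) := by
    rw [hx0, hy0, h.germChord_zero]
  have hl := hasDerivAt_im (HasDerivAt.clog_real (f := fun t => germChord α N (x t) (y t)) hc
    (by rw [hb]; exact h.base_mem_slitPlane hα))
  refine hl.congr_deriv ?_
  rw [hb, Complex.div_ofReal_im, exp_I_mul_eq, exp_I_mul_eq]
  have := h.pos
  simp
  field_simp
  ring

theorem hasDerivAt_outMomentum (h : IsNormalizedGerm N ρ g) (hα : 0 < Real.sin α)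
    {x y : ℝ → ℝ} {x' y' : ℝ} (hx : HasDerivAt x x' 0) (hy : HasDerivAt y y' 0)
    (hx0 : x 0 = 0) (hy0 : y 0 = 0) :
    HasDerivAt (fun t => outMomentum α N (x t) (y t))
      (-Real.sin α * ((x' + y') / (2 * g) - x')) 0 := by
  have h1 := ((hx.const_sub α).add (h.hasDerivAt_log_germChord hα hx hy hx0 hy0)).cos
  refine h1.congr_deriv ?_
  simp only [Pi.add_apply]
  rw [hx0, hy0, h.germChord_zero, Complex.log_im,
    Complex.arg_ofReal_of_nonneg (by have := h.pos; positivity)]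
  rw [sub_zero, add_zero]
  ring

theorem hasDerivAt_inMomentum (h : IsNormalizedGerm N ρ g) (hα : 0 < Real.sin α)
    {x y : ℝ → ℝ} {x' y' : ℝ} (hx : HasDerivAt x x' 0) (hy : HasDerivAt y y' 0)
    (hx0 : x 0 = 0) (hy0 : y 0 = 0) :
    HasDerivAt (fun t => inMomentum α N (x t) (y t))
      (Real.sin α * ((x' + y') / (2 * g) - y')) 0 := by
  have h1 := (((h.hasDerivAt_log_germChord hα hx hy hx0 hy0).sub_const α).sub hy).cos
  refine h1.congr_deriv ?_
  simp only [Pi.sub_apply]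
  rw [hx0, hy0, h.germChord_zero, Complex.log_im,
    Complex.arg_ofReal_of_nonneg (by have := h.pos; positivity)]
  rw [sub_zero, zero_sub, Real.sin_neg]
  ring

theorem outMomentum_zero (h : IsNormalizedGerm N ρ g) (hα : 0 < Real.sin α) :
    outMomentum α N 0 0 = Real.cos α := by
  rw [outMomentum, h.germChord_zero, Complex.log_im,
    Complex.arg_ofReal_of_nonneg (by have := h.pos; positivity), sub_zero, add_zero]

/-- For consecutive chords `c`, `c'` put `δ = arg c + arg c' - 2y`. The momenta differ by at most
`|δ|`, while the defect is `Im(c c' e^{-2iy}) = |c||c'| sin δ`. The chords are bounded below, and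
`|δ| ≤ (π/2)|sin δ|` for small `δ`. -/
theorem inMomentum_sub_outMomentum_isBigO (h : IsNormalizedGerm N ρ g) (hα : 0 < Real.sin α)
    {ι : Type*} {l : Filter ι} {x y z : ι → ℝ} (hx : Filter.Tendsto x l (𝓝 0))
    (hy : Filter.Tendsto y l (𝓝 0)) (hz : Filter.Tendsto z l (𝓝 0)) :
    (fun i => inMomentum α N (x i) (y i) - outMomentum α N (y i) (z i)) =O[l]
      fun i => reflectionDefect (Real.cos α) (Real.sin α) (fun x => (N x).re)
        (fun x => (N x).im) (x i) (y i) (z i) := by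
  have hxy : Filter.Tendsto (fun i => (x i, y i)) l (𝓝 (0 : ℝ × ℝ)) := hx.prodMk_nhds hy
  have hyz : Filter.Tendsto (fun i => (y i, z i)) l (𝓝 (0 : ℝ × ℝ)) := hy.prodMk_nhds hz
  have hd := (((h.tendsto_log_germChord hα).comp hxy).add
    ((h.tendsto_log_germChord hα).comp hyz)).sub (hy.const_mul 2)
  simp only [Function.comp_apply, mul_zero, add_zero, sub_zero] at hd
  have hpi := Real.pi_pos
  have hsmall := hd.abs.eventually (gt_mem_nhds (show |(0 : ℝ)| < Real.pi / 2 by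
    rw [abs_zero]; positivity))
  have hm : 0 < g * Real.sin α := mul_pos h.pos hα
  refine Asymptotics.IsBigO.of_bound (Real.pi / 2 / (g * Real.sin α) ^ 2) ?_
  filter_upwards [hsmall, hxy.eventually (h.eventually_germChord hα),
    hyz.eventually (h.eventually_germChord hα)] with i hi h1 h2
  simp only [Complex.log_im] at hi
  rw [reflectionDefect, ← germChord_re, ← germChord_re, ← germChord_im, ← germChord_im]
  rw [inMomentum, outMomentum, Complex.log_im, Complex.log_im]
  set c := germChord α N (x i) (y i)
  set c' := germChord α N (y i) (z i)
  set δ := c.arg + c'.arg - 2 * y i with hδ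
  have e1 : (c.re * c'.im + c.im * c'.re) * Real.cos (2 * y i)
      - (c.re * c'.re - c.im * c'.im) * Real.sin (2 * y i) = ‖c‖ * ‖c'‖ * Real.sin δ := by
    rw [← Complex.norm_mul_cos_arg c, ← Complex.norm_mul_cos_arg c',
      ← Complex.norm_mul_sin_arg c, ← Complex.norm_mul_sin_arg c', hδ, Real.sin_sub,
      Real.sin_add, Real.cos_add]
    ring
  have e2 : |Real.cos (c.arg - α - y i) - Real.cos (α - y i + c'.arg)| ≤ |δ| := by
    rw [← Real.cos_neg (α - y i + c'.arg)]
    refine (Real.abs_cos_sub_cos_le _ _).trans (le_of_eq ?_)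
    congr 1; rw [hδ]; ring
  have e3 := Real.mul_abs_le_abs_sin hi.le
  have e4 : |δ| ≤ Real.pi / 2 * |Real.sin δ| := by
    calc |δ| = Real.pi / 2 * (2 / Real.pi * |δ|) := by field_simp
      _ ≤ _ := by gcongr
  rw [e1, Real.norm_eq_abs, Real.norm_eq_abs, abs_mul, abs_mul, abs_norm, abs_norm]
  calc _ ≤ Real.pi / 2 * |Real.sin δ| := e2.trans e4
    _ = Real.pi / 2 / (g * Real.sin α) ^ 2 *
        ((g * Real.sin α) * (g * Real.sin α) * |Real.sin δ|) := by
      have := hm.ne'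
      rw [← sq, ← mul_assoc, div_mul_cancel₀ _ (pow_ne_zero 2 this)]
    _ ≤ _ := by
      have := h1.2.le
      have := h2.2.le
      gcongr

end IsNormalizedGerm

/-! ### The twist coefficient of a germ. -/

theorem contDiff_orbitPosition (q₁ q₂ p c₁ c₂ : ℝ) :
    ContDiff ℝ ∞ (orbitPosition q₁ q₂ p c₁ c₂) := by
  have hr : ContDiff ℝ ∞ (fun w : ℂ => w.re) := Complex.reCLM.contDiff
  have hi : ContDiff ℝ ∞ (fun w : ℂ => w.im) := Complex.imCLM.contDiff
  have hn : ContDiff ℝ ∞ (fun w : ℂ => ‖w‖ ^ 2) := contDiff_norm_sq ℝ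
  unfold orbitPosition
  fun_prop

@[simp] theorem orbitPosition_zero (q₁ q₂ p c₁ c₂ : ℝ) : orbitPosition q₁ q₂ p c₁ c₂ 0 = 0 := by
  simp [orbitPosition]

theorem twistMap_zero_zero (z : ℂ) : twistMap 0 0 z = z := by simp [twistMap]

theorem HasCubicExpansion.hasDerivAt_line {f : ℂ → ℝ} {a₀ : ℝ} {a₁ a₂ a₃ : ℂ → ℝ}
    (hf : HasCubicExpansion f a₀ a₁ a₂ a₃) (h0 : f 0 = a₀) {v : ℂ} {m : ℝ}
    (hm : ∀ s : ℝ, a₁ (s * v) = s * m) : HasDerivAt (fun s : ℝ => f (s * v)) m 0 := by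
  have h1 : (fun z => f z - a₀ - a₁ z) =o[𝓝 0] fun z => ‖z‖ ^ 1 := by
    have := ((hf.rem.trans (norm_pow_isBigO (show 2 ≤ 4 by norm_num))).add hf.two).add
      (hf.three.trans (norm_pow_isBigO (show 2 ≤ 3 by norm_num)))
    exact (this.congr_left fun z => by ring).trans_isLittleO
      (norm_pow_isLittleO (show 1 < 2 by norm_num))
  have ht : Filter.Tendsto (fun s : ℝ => (s : ℂ) * v) (𝓝 0) (𝓝 0) := by
    have : Continuous (fun s : ℝ => (s : ℂ) * v) := by fun_prop
    simpa using this.tendsto 0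
  have h2 := h1.comp_tendsto ht
  rw [hasDerivAt_iff_isLittleO_nhds_zero]
  refine (h2.trans_isBigO (Asymptotics.IsBigO.of_bound ‖v‖ (Filter.Eventually.of_forall
    fun s => ?_))).congr_left fun s => ?_
  · simp [mul_comm]
  · simp [hm, h0]

/-- The twist coefficient of a map which in a neighbourhood of `P` is the billiard map of a germ. -/
theorem IsNormalizedGerm.isTwistCoefficient_iff {N : ℝ → ℂ} {ρ : ℝ → ℝ} {α θ : ℝ}
    (hN : IsNormalizedGerm N ρ ((1 + Real.cos θ) / 2)) (hα : 0 < Real.sin α)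
    (hθ : 0 < Real.sin θ) {S : ℝ → ℝ} (hS : ContDiff ℝ ∞ S) {r : ℝ} (hr : 0 < r)
    (hS' : HasDerivAt S r 0) {F : ℝ × ℝ → ℝ × ℝ} {P : ℝ × ℝ} (hP : P = (S 0, Real.cos α))
    (hFP : F P = P)
    (hF : ∀ᶠ v : ℝ × ℝ in 𝓝 0,
      F (S v.1, outMomentum α N v.1 v.2) = (S v.2, inMomentum α N v.1 v.2))
    {q h p c e t : ℝ}
    (hc : OrbitCoefficients (Real.cos θ) (Real.sin θ) (Real.cos α / Real.sin α) (deriv ρ 0)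
      (deriv (deriv ρ) 0) q h p c e t) :
    ∃ μ : ℝ, 0 < μ ∧ ∀ τ : ℝ, IsTwistCoefficient F P τ ↔ τ = t * μ := by
  have hκ : 0 < 1 + Real.cos θ := by have := hN.pos; linarith
  -- The scale `w = μz` that makes the Jacobian of `Φ` at 0 equal to 1; see `hJ`.
  set μ : ℝ := √((1 + Real.cos θ) / (4 * r * Real.sin α * Real.sin θ)) with hμ
  have hμ0 : 0 < μ := Real.sqrt_pos.2 (by positivity)
  have hμ2 : μ ^ 2 = (1 + Real.cos θ) / (4 * r * Real.sin α * Real.sin θ) :=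
    Real.sq_sqrt (by positivity)
  set X := orbitPosition q (Real.sin θ * h) p c (Real.sin θ * e) with hX
  have hXs : ContDiff ℝ ∞ X := contDiff_orbitPosition _ _ _ _ _
  set x : ℂ → ℝ := fun z => X (μ * z) with hx
  set y : ℂ → ℝ := fun z => X (twistMap θ t (μ * z)) with hy
  have hxs : ContDiff ℝ ∞ x := hXs.comp (contDiff_const.mul contDiff_id)
  have hys : ContDiff ℝ ∞ y := hXs.comp ((contDiff_twistMap θ t).comp
    (contDiff_const.mul contDiff_id))
  have hx0 : x 0 = 0 := by simp [hx, hX]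
  have hy0 : y 0 = 0 := by simp [hy, hX]
  have hxy : Filter.Tendsto (fun z => (x z, y z)) (𝓝 0) (𝓝 (0 : ℝ × ℝ)) := by
    have := (hxs.continuous.prodMk hys.continuous).tendsto 0
    rwa [hx0, hy0] at this
  -- The phase point that leaves the position `x z` towards the next position `y z` of the trial
  -- orbit.
  set Φ : ℂ → ℝ × ℝ := fun z => (S (x z), outMomentum α N (x z) (y z)) with hΦ
  have hΦs : ∀ᶠ z in 𝓝 0, ContDiffAt ℝ ∞ Φ z := by
    filter_upwards [hxy.eventually (hN.eventually_germChord hα)] with z hz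
    exact (hS.comp hxs).contDiffAt.prodMk
      (hN.contDiffAt_outMomentum hxs.contDiffAt hys.contDiffAt hz.1)
  have hΦ0 : Φ 0 = P := by
    simp only [hΦ]
    rw [hx0, hy0, hN.outMomentum_zero hα, hP]
  -- the derivative of `Φ`
  have hder : ∀ v : ℂ, fderiv ℝ Φ 0 v = (r * (2 * μ * v.re),
      -Real.sin α * ((2 * μ * v.re + 2 * μ * (Real.cos θ * v.re - Real.sin θ * v.im))
        / (1 + Real.cos θ) - 2 * μ * v.re)) := by
    intro v
    have hxd : HasDerivAt (fun s : ℝ => x (s * v)) (2 * μ * v.re) 0 := by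
      have h1 := orbitPosition_twistMap_expansion q (Real.sin θ * h) p c (Real.sin θ * e) 0 0
      simp only [twistMap_zero_zero] at h1
      have h2 := h1.hasDerivAt_line (v := μ * v) (m := 2 * μ * v.re) (by simp) (fun s => by
        simp; ring)
      have e : (fun s : ℝ => x (s * v)) = fun s : ℝ => X (s * (μ * v)) := by
        funext s; simp only [hx]; congr 1; ring
      rw [e]; exact h2
    have hyd : HasDerivAt (fun s : ℝ => y (s * v))
        (2 * μ * (Real.cos θ * v.re - Real.sin θ * v.im)) 0 := by
      have h1 := orbitPosition_twistMap_expansion q (Real.sin θ * h) p c (Real.sin θ * e) θ t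
      have h2 := h1.hasDerivAt_line (v := μ * v)
        (m := 2 * μ * (Real.cos θ * v.re - Real.sin θ * v.im)) (by simp) (fun s => by
          simp [-Complex.ofReal_sin, -Complex.ofReal_cos]; ring)
      have e : (fun s : ℝ => y (s * v)) = fun s : ℝ => X (twistMap θ t (s * (μ * v))) := by
        funext s; simp only [hy]; congr 2; ring
      rw [e]; exact h2
    have h1 : HasDerivAt (fun s : ℝ => Φ (s * v)) _ 0 := HasDerivAt.prodMk
      (HasDerivAt.comp (0 : ℝ) (by simpa [hx0] using hS') hxd)
      (hN.hasDerivAt_outMomentum hα hxd hyd (by simp [hx0]) (by simp [hy0]))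
    have h2 : HasDerivAt (fun s : ℝ => Φ (s * v)) (fderiv ℝ Φ 0 v) 0 := by
      have hd : HasFDerivAt Φ (fderiv ℝ Φ 0) ((0 : ℝ) * v) := by
        simpa using (hΦs.self_of_nhds.differentiableAt (by simp)).hasFDerivAt
      have hl : HasDerivAt (fun s : ℝ => (s : ℂ) * v) v 0 := by
        simpa using (Complex.ofRealCLM.hasDerivAt (x := (0 : ℝ))).mul_const v
      exact hd.comp_hasDerivAt (0 : ℝ) hl
    rw [h2.unique h1]
    congr 4
    ring
  have hJ : (fderiv ℝ Φ 0 1).1 * (fderiv ℝ Φ 0 Complex.I).2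
      - (fderiv ℝ Φ 0 1).2 * (fderiv ℝ Φ 0 Complex.I).1 = 1 := by
    rw [hder, hder]
    simp only [Complex.one_re, Complex.one_im, Complex.I_re, Complex.I_im]
    have : μ ^ 2 * (4 * r * Real.sin α * Real.sin θ) / (1 + Real.cos θ) = 1 := by
      rw [hμ2]; field_simp
    refine Eq.trans ?_ this
    ring
  -- the conjugacy
  have htw : ∀ z : ℂ, μ * twistMap θ (t * μ ^ 2) z = twistMap θ t (μ * z) := by
    intro z
    rw [twistMap, twistMap, norm_mul, Complex.norm_real, Real.norm_eq_abs, abs_of_pos hμ0]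
    push_cast
    rw [mul_pow]
    ring_nf
  have hconj : (fun z => F (Φ z) - Φ (twistMap θ (t * μ ^ 2) z)) =O[𝓝 0] fun z => ‖z‖ ^ 4 := by
    have hR := reflectionDefect_isBigO hN.re_taylor hN.im_taylor
      (k := Real.cos α) (s := Real.sin α) (by field_simp) hc
    have hX0 : Filter.Tendsto X (𝓝 0) (𝓝 0) := by
      have := hXs.continuous.tendsto 0
      rwa [hX, orbitPosition_zero] at this
    have hG := (hN.inMomentum_sub_outMomentum_isBigO hα
      (hX0.comp (tendsto_twistMap (-θ) (-t))) (hX0.comp (tendsto_twistMap 0 0))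
      (hX0.comp (tendsto_twistMap θ t))).trans hR
    have hw : Filter.Tendsto (fun z : ℂ => twistMap θ t (μ * z)) (𝓝 0) (𝓝 0) := by
      have : Continuous (fun z : ℂ => twistMap θ t (μ * z)) :=
        (contDiff_twistMap θ t).continuous.comp (by fun_prop)
      simpa using this.tendsto 0
    have hn : (fun z : ℂ => ‖twistMap θ t (μ * z)‖ ^ 4) =O[𝓝 0] fun z => ‖z‖ ^ 4 :=
      Asymptotics.IsBigO.of_bound (μ ^ 4) (Filter.Eventually.of_forall fun z => by
        simp [norm_twistMap, mul_pow, abs_of_pos hμ0])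
    have hG' := (hG.comp_tendsto hw).trans hn
    -- The arc length components of `F (Φ z)` and of `Φ` at the twisted point agree exactly; only
    -- the incoming and outgoing momenta at the middle point differ, and the reflection defect
    -- controls them.
    refine (Asymptotics.IsBigO.of_norm_eventuallyLE ?_).trans hG'.norm_left
    filter_upwards [hxy.eventually hF] with z hz
    have e1 : F (Φ z) = (S (y z), inMomentum α N (x z) (y z)) := hz
    have e2 : Φ (twistMap θ (t * μ ^ 2) z)
        = (S (y z), outMomentum α N (y z) (X (twistMap θ t (twistMap θ t (μ * z))))) := by
      simp only [hΦ, hx, hy]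
      rw [htw]
    have e3 : twistMap (-θ) (-t) (twistMap θ t (μ * z)) = μ * z := by
      rw [twistMap_twistMap]; simp [twistMap_zero_zero]
    rw [e1, e2, Prod.mk_sub_mk, sub_self, Prod.norm_mk, norm_zero,
      max_eq_right (norm_nonneg _)]
    simp only [Function.comp_apply, e3, twistMap_zero_zero]
    exact le_rfl
  refine ⟨μ ^ 2, by positivity, fun τ => ⟨fun hτ => ?_, fun hτ => ?_⟩⟩
  · exact twistCoefficient_unique hθ.ne' hΦs hΦ0 hJ hconj hτ
  · rw [hτ]
    exact isTwistCoefficient_of_parametrization hFP hΦs hΦ0 hJ hconj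

/-! ### Ellipticity and the trace. -/

theorem charpoly_prod_eq (L : ℝ × ℝ →L[ℝ] ℝ × ℝ) :
    LinearMap.charpoly L.toLinearMap = Polynomial.X ^ 2
      - Polynomial.C ((L (1, 0)).1 + (L (0, 1)).2) * Polynomial.X
      + Polynomial.C ((L (1, 0)).1 * (L (0, 1)).2 - (L (0, 1)).1 * (L (1, 0)).2) := by
  rw [← LinearMap.charpoly_toMatrix L.toLinearMap (Module.Basis.finTwoProd ℝ),
    Matrix.charpoly_fin_two, Matrix.trace_fin_two, Matrix.det_fin_two]
  simp [LinearMap.toMatrix_apply]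

/-- The trace of an elliptic map of the plane is less than two. -/
theorem trace_lt_two_of_elliptic {L : ℝ × ℝ →L[ℝ] ℝ × ℝ} {z : ℂ} (hz : ‖z‖ = 1) (hi : z.im ≠ 0)
    (h : Polynomial.aeval z (LinearMap.charpoly L.toLinearMap) = 0) :
    (L (1, 0)).1 + (L (0, 1)).2 < 2 := by
  rw [charpoly_prod_eq] at h
  simp only [map_add, map_sub, map_mul, map_pow, Polynomial.aeval_X, Polynomial.aeval_C,
    Complex.coe_algebraMap] at h
  set T := (L (1, 0)).1 + (L (0, 1)).2
  have him := congrArg Complex.im h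
  simp [pow_two] at him
  have h1 : z.im * (2 * z.re - T) = 0 := by
    linear_combination him
  have h2 : 2 * z.re = T := by
    rcases mul_eq_zero.1 h1 with h0 | h0
    · exact absurd h0 hi
    · linarith
  have h3 : z.re ^ 2 + z.im ^ 2 = 1 := by
    have := Complex.sq_norm z
    rw [hz, Complex.normSq_apply] at this; linarith
  have : 0 < z.im ^ 2 := by positivity
  nlinarith

/-- Differentiating the implicit relation `hF` along motions of the two end points determines the
derivative of `F`. Both its diagonal entries are `2g - 1`, so ellipticity gives `4g - 2 < 2`. -/
theorem IsNormalizedGerm.lt_one_of_elliptic {N : ℝ → ℂ} {ρ : ℝ → ℝ} {g α : ℝ}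
    (hN : IsNormalizedGerm N ρ g) (hα : 0 < Real.sin α) {S : ℝ → ℝ} {r : ℝ} (hr : 0 < r)
    (hS' : HasDerivAt S r 0) {F : ℝ × ℝ → ℝ × ℝ} {P : ℝ × ℝ} (hP : P = (S 0, Real.cos α))
    (hF : ∀ᶠ v : ℝ × ℝ in 𝓝 0,
      F (S v.1, outMomentum α N v.1 v.2) = (S v.2, inMomentum α N v.1 v.2))
    (hell : IsEllipticFixedPoint F P) : g < 1 := by
  obtain ⟨-, hd, z, hz, hi, hchar⟩ := hell
  set L := fderiv ℝ F P with hL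
  have hg := hN.pos
  have key : ∀ a b : ℝ, L (r * a, -Real.sin α * ((a + b) / (2 * g) - a))
      = (r * b, Real.sin α * ((a + b) / (2 * g) - b)) := by
    intro a b
    have ha : HasDerivAt (fun s : ℝ => s * a) a 0 := by
      simpa using (hasDerivAt_id (0 : ℝ)).mul_const a
    have hb : HasDerivAt (fun s : ℝ => s * b) b 0 := by
      simpa using (hasDerivAt_id (0 : ℝ)).mul_const b
    have hSa : HasDerivAt (fun s : ℝ => S (s * a)) (r * a) 0 :=
      HasDerivAt.comp (0 : ℝ) (by simpa using hS') ha
    have hSb : HasDerivAt (fun s : ℝ => S (s * b)) (r * b) 0 :=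
      HasDerivAt.comp (0 : ℝ) (by simpa using hS') hb
    have h1 := hSa.prodMk (hN.hasDerivAt_outMomentum hα ha hb (by simp) (by simp))
    have h2 := hSb.prodMk (hN.hasDerivAt_inMomentum hα ha hb (by simp) (by simp))
    have hdF : HasFDerivAt F L (S (0 * a), outMomentum α N (0 * a) (0 * b)) := by
      rw [zero_mul, zero_mul, hN.outMomentum_zero hα, ← hP]
      exact hd.hasFDerivAt
    have h3 := hdF.comp_hasDerivAt (0 : ℝ) h1
    have ht : Filter.Tendsto (fun s : ℝ => (s * a, s * b)) (𝓝 0) (𝓝 (0 : ℝ × ℝ)) := by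
      have h4 : Continuous (fun s : ℝ => (s * a, s * b)) := by fun_prop
      have h5 := h4.tendsto 0
      rwa [zero_mul, zero_mul] at h5
    refine h3.unique (h2.congr_of_eventuallyEq ?_)
    filter_upwards [ht.eventually hF] with s hs
    exact hs
  have htr := trace_lt_two_of_elliptic hz hi hchar
  have hLv : ∀ u v : ℝ, L (u, v) = u • L (1, 0) + v • L (0, 1) := by
    intro u v
    rw [← map_smul, ← map_smul, ← map_add]
    simp
  have k1 := key 0 1
  have k2 := key 1 0
  rw [hLv] at k1 k2
  have f1 := congrArg Prod.fst k2
  have f2 := congrArg Prod.fst k1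
  have f3 := congrArg Prod.snd k1
  simp only [Prod.fst_add, Prod.snd_add, Prod.smul_fst, Prod.smul_snd, smul_eq_mul] at f1 f2 f3
  set A := (L (1, 0)).1
  set B := (L (0, 1)).1
  set D := (L (0, 1)).2
  have hs := hα.ne'
  obtain ⟨κ, hκ⟩ : ∃ κ : ℝ, κ * (2 * g) = 1 := ⟨1 / (2 * g), by field_simp⟩
  have hκ' : 1 / (2 * g) = κ := by rw [← hκ]; field_simp
  simp only [zero_add, add_zero, hκ'] at f1 f2 f3
  have eD : D = 2 * g - 1 := mul_left_cancel₀ hs (by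
    linear_combination (-(2 * g)) * f3 - (Real.sin α + Real.sin α * D) * hκ)
  have eB : B * Real.sin α = -(r * (2 * g)) := by
    linear_combination (-(2 * g)) * f2 - (Real.sin α * B) * hκ
  have eA : r * A = r * (2 * g - 1) := by
    linear_combination f1 + (κ - 1) * eB - r * hκ
  have eA' := mul_left_cancel₀ hr.ne' eA
  linarith

/-! ### Geometry of symmetric ovals and the billiard map. -/

namespace IsSymmetricOval

variable {n : ℕ} {γ : ℝ → ℂ}

theorem deriv_eq (hγ : IsSymmetricOval n γ) (φ : ℝ) :
    deriv γ φ = (‖deriv γ φ‖ : ℂ) * Complex.exp (Complex.I * φ) := by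
  obtain ⟨r, hr, h⟩ := hγ.tangent φ
  have : ‖deriv γ φ‖ = r := by
    rw [h, norm_mul, norm_exp_I_mul, mul_one, Complex.norm_real, Real.norm_eq_abs, abs_of_pos hr]
  rw [this, h]

theorem norm_deriv_pos (hγ : IsSymmetricOval n γ) (φ : ℝ) : 0 < ‖deriv γ φ‖ := by
  obtain ⟨r, hr, h⟩ := hγ.tangent φ
  rw [h, norm_mul, norm_exp_I_mul, mul_one, Complex.norm_real, Real.norm_eq_abs, abs_of_pos hr]
  exact hr

theorem hasDerivAt (hγ : IsSymmetricOval n γ) (φ : ℝ) :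
    HasDerivAt γ ((‖deriv γ φ‖ : ℂ) * Complex.exp (Complex.I * φ)) φ := by
  rw [← hγ.deriv_eq]
  exact (hγ.smooth.differentiable (by simp) φ).hasDerivAt

/-- The speed is `Re(γ'(φ) e^{-iφ})`, which avoids differentiating the norm. -/
theorem contDiff_norm_deriv (hγ : IsSymmetricOval n γ) :
    ContDiff ℝ ∞ (fun φ => ‖deriv γ φ‖) := by
  have h1 : ContDiff ℝ ∞ (deriv γ) := (contDiff_infty_iff_deriv.1 hγ.smooth).2
  have hx : ContDiff ℝ ∞ (fun x : ℝ => (x : ℂ)) := Complex.ofRealCLM.contDiff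
  have h2 : ContDiff ℝ ∞ (fun φ : ℝ => (deriv γ φ * Complex.exp (-(Complex.I * φ))).re) :=
    Complex.reCLM.contDiff.comp (h1.mul (contDiff_const.mul hx).neg.cexp)
  convert h2 using 2 with φ
  conv_rhs => rw [hγ.deriv_eq φ]
  have := exp_neg_mul_exp_I φ
  rw [mul_assoc, mul_comm (Complex.exp _), this, mul_one, Complex.ofReal_re]

theorem rotate (hγ : IsSymmetricOval n γ) (k : ℕ) (φ : ℝ) :
    γ (φ + k * (2 * Real.pi / n))
      = Complex.exp (Complex.I * ((k * (2 * Real.pi / n) : ℝ) : ℂ)) * γ φ := by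
  induction k with
  | zero => simp
  | succ k ih =>
    have : φ + ((k + 1 : ℕ) : ℝ) * (2 * Real.pi / n)
        = φ + k * (2 * Real.pi / n) + 2 * Real.pi / n := by push_cast; ring
    rw [this, hγ.symmetric, ih, ← mul_assoc, ← Complex.exp_add]
    congr 2; push_cast; ring

theorem deriv_rotate (hγ : IsSymmetricOval n γ) (k : ℕ) (φ : ℝ) :
    ‖deriv γ (φ + k * (2 * Real.pi / n))‖ = ‖deriv γ φ‖ := by
  have h1 : deriv (fun φ => γ (φ + k * (2 * Real.pi / n))) φ
      = deriv γ (φ + k * (2 * Real.pi / n)) := deriv_comp_add_const _ _ _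
  rw [← h1, show (fun φ => γ (φ + k * (2 * Real.pi / n))) = fun φ =>
    Complex.exp (Complex.I * ((k * (2 * Real.pi / n) : ℝ) : ℂ)) * γ φ from
    funext (hγ.rotate k), deriv_const_mul _ (hγ.hasDerivAt φ).differentiableAt,
    norm_mul, norm_exp_I_mul, one_mul]

theorem periodic (hγ : IsSymmetricOval n γ) (hn : n ≠ 0) (φ : ℝ) : γ (φ + 2 * Real.pi) = γ φ := by
  have h := hγ.rotate n φ
  have e : (n : ℝ) * (2 * Real.pi / n) = 2 * Real.pi := by field_simp
  rw [e] at h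
  rw [h]
  have : Complex.I * ((2 * Real.pi : ℝ) : ℂ) = 2 * Real.pi * Complex.I := by push_cast; ring
  rw [this, Complex.exp_two_pi_mul_I, one_mul]

theorem hasDerivAt_arcLength (hγ : IsSymmetricOval n γ) (φ : ℝ) :
    HasDerivAt (arcLength γ) ‖deriv γ φ‖ φ :=
  hγ.contDiff_norm_deriv.continuous.integral_hasStrictDerivAt 0 φ |>.hasDerivAt

theorem contDiff_arcLength (hγ : IsSymmetricOval n γ) : ContDiff ℝ ∞ (arcLength γ) := by
  refine contDiff_infty_iff_deriv.2
    ⟨fun φ => (hγ.hasDerivAt_arcLength φ).differentiableAt, ?_⟩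
  rw [show deriv (arcLength γ) = fun φ => ‖deriv γ φ‖ from
    funext fun φ => (hγ.hasDerivAt_arcLength φ).deriv]
  exact hγ.contDiff_norm_deriv

theorem strictMono_arcLength (hγ : IsSymmetricOval n γ) : StrictMono (arcLength γ) :=
  strictMono_of_deriv_pos fun φ => by
    rw [(hγ.hasDerivAt_arcLength φ).deriv]; exact hγ.norm_deriv_pos φ

/-- Rotation preserves speed, so the arc gained over `k` steps does not depend on the start and is
additive in `k`; `n` steps give the whole perimeter. -/
theorem arcLength_rotate (hγ : IsSymmetricOval n γ) (hn : n ≠ 0) (k : ℕ) (φ : ℝ) :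
    arcLength γ (φ + k * (2 * Real.pi / n))
      = arcLength γ φ + (k / n : ℝ) * arcLength γ (2 * Real.pi) := by
  have h0 : arcLength γ 0 = 0 := by simp [arcLength]
  have key : ∀ (k : ℕ) (φ : ℝ), arcLength γ (φ + k * (2 * Real.pi / n))
      = arcLength γ φ + arcLength γ (k * (2 * Real.pi / n)) := by
    intro k φ
    have hd : ∀ x, HasDerivAt (fun φ => arcLength γ (φ + k * (2 * Real.pi / n)) - arcLength γ φ)
        0 x := by
      intro x
      have h1 := (hγ.hasDerivAt_arcLength (x + k * (2 * Real.pi / n))).comp_add_const x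
        (k * (2 * Real.pi / n))
      rw [hγ.deriv_rotate] at h1
      exact (h1.sub (hγ.hasDerivAt_arcLength x)).congr_deriv (sub_self _)
    have := is_const_of_deriv_eq_zero (fun x => (hd x).differentiableAt)
      (fun x => (hd x).deriv) φ 0
    simp only [zero_add, h0, sub_zero] at this
    linarith
  have hmul : ∀ k : ℕ, arcLength γ (k * (2 * Real.pi / n))
      = k * arcLength γ (2 * Real.pi / n) := by
    intro k
    induction k with
    | zero => simp [h0]
    | succ k ih =>
      have := key 1 (k * (2 * Real.pi / n))
      rw [ih] at this
      push_cast at this ⊢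
      rw [one_mul] at this
      rw [add_mul, one_mul, this]; ring
  have hnn : arcLength γ (2 * Real.pi) = n * arcLength γ (2 * Real.pi / n) := by
    rw [← hmul n]; congr 1; field_simp
  rw [key, hmul, hnn]
  field_simp

theorem arcLength_two_pi_pos (hγ : IsSymmetricOval n γ) : 0 < arcLength γ (2 * Real.pi) := by
  have h := hγ.strictMono_arcLength (show (0 : ℝ) < 2 * Real.pi by have := Real.pi_pos; positivity)
  simpa [arcLength] using h

/-- The component of the displacement along the oval in a fixed direction. -/
theorem hasDerivAt_im_displacement (hγ : IsSymmetricOval n γ) (η : ℝ) (z : ℂ) (t : ℝ) :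
    HasDerivAt (fun t => (Complex.exp (-(Complex.I * η)) * (γ t - z)).im)
      (‖deriv γ t‖ * Real.sin (t - η)) t := by
  have h := hasDerivAt_im (((hγ.hasDerivAt t).sub_const z).const_mul
    (Complex.exp (-(Complex.I * η))))
  refine h.congr_deriv ?_
  have : Complex.exp (-(Complex.I * η)) * ((‖deriv γ t‖ : ℂ) * Complex.exp (Complex.I * t))
      = (‖deriv γ t‖ : ℂ) * Complex.exp (Complex.I * ((t - η : ℝ) : ℂ)) := by
    rw [mul_left_comm, ← Complex.exp_add]; congr 2; push_cast; ring
  rw [this, exp_I_mul_eq]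
  simp [-Complex.ofReal_sub]

/-- The oval lies strictly to the left of each of its tangents. -/
theorem im_displacement_pos (hγ : IsSymmetricOval n γ) (hn : n ≠ 0) {φ ψ : ℝ} (h1 : φ < ψ)
    (h2 : ψ < φ + 2 * Real.pi) :
    0 < (Complex.exp (-(Complex.I * φ)) * (γ ψ - γ φ)).im := by
  set f : ℝ → ℝ := fun t => (Complex.exp (-(Complex.I * φ)) * (γ t - γ φ)).im with hf
  have hd : ∀ t, HasDerivAt f (‖deriv γ t‖ * Real.sin (t - φ)) t :=
    fun t => hγ.hasDerivAt_im_displacement φ (γ φ) t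
  have hc : Continuous f := continuous_iff_continuousAt.2 fun t => (hd t).continuousAt
  have f0 : f φ = 0 := by simp [hf]
  have f1 : f (φ + 2 * Real.pi) = 0 := by simp [hf, hγ.periodic hn]
  have hpi := Real.pi_pos
  change 0 < f ψ
  -- The height above the tangent increases over the first half turn and decreases back to 0 over
  -- the second.
  rcases le_or_gt ψ (φ + Real.pi) with h | h
  · have hm : StrictMonoOn f (Set.Icc φ (φ + Real.pi)) := by
      refine strictMonoOn_of_deriv_pos (convex_Icc _ _) hc.continuousOn fun t ht => ?_
      rw [interior_Icc] at ht
      rw [(hd t).deriv]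
      exact mul_pos (hγ.norm_deriv_pos t) (Real.sin_pos_of_pos_of_lt_pi (by linarith [ht.1])
        (by linarith [ht.2]))
    have := hm ⟨le_rfl, by linarith⟩ ⟨h1.le, h⟩ h1
    rwa [f0] at this
  · have hm : StrictAntiOn f (Set.Icc (φ + Real.pi) (φ + 2 * Real.pi)) := by
      refine strictAntiOn_of_deriv_neg (convex_Icc _ _) hc.continuousOn fun t ht => ?_
      rw [interior_Icc] at ht
      rw [(hd t).deriv]
      refine mul_neg_of_pos_of_neg (hγ.norm_deriv_pos t) ?_
      rw [← neg_pos, ← Real.sin_sub_pi]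
      exact Real.sin_pos_of_pos_of_lt_pi (by linarith [ht.1]) (by linarith [ht.2])
    have := hm ⟨h.le, h2.le⟩ ⟨by linarith, le_rfl⟩ h2
    rwa [f1] at this

theorem cos_angle_tangent (hγ : IsSymmetricOval n γ) (φ : ℝ) (z : ℂ) :
    Real.cos (InnerProductGeometry.angle (deriv γ φ) z)
      = (Complex.exp (-(Complex.I * φ)) * z).re / ‖z‖ := by
  have hr := hγ.norm_deriv_pos φ
  rw [InnerProductGeometry.cos_angle, Complex.inner]
  conv_lhs => enter [1]; rw [hγ.deriv_eq φ]
  have e : (starRingEnd ℂ) ((‖deriv γ φ‖ : ℂ) * Complex.exp (Complex.I * φ))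
      = (‖deriv γ φ‖ : ℂ) * Complex.exp (-(Complex.I * φ)) := by
    rw [map_mul, Complex.conj_ofReal, ← Complex.exp_conj, map_mul, Complex.conj_I,
      Complex.conj_ofReal, neg_mul]
  rw [e, mul_left_comm, mul_comm z, Complex.re_ofReal_mul, mul_div_mul_left _ _ hr.ne']

/-- A chord meets the oval again in at most one point. -/
theorem eq_of_same_direction (hγ : IsSymmetricOval n γ) (hn : n ≠ 0) {φ ψ ψ' : ℝ} (h1 : φ < ψ)
    (h2 : ψ < φ + 2 * Real.pi) (h1' : φ < ψ') (h2' : ψ' < φ + 2 * Real.pi)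
    (h : Real.cos (InnerProductGeometry.angle (deriv γ φ) (γ ψ - γ φ))
      = Real.cos (InnerProductGeometry.angle (deriv γ φ) (γ ψ' - γ φ))) : ψ = ψ' := by
  rw [hγ.cos_angle_tangent, hγ.cos_angle_tangent] at h
  have hc := hγ.im_displacement_pos hn h1 h2
  have hc' := hγ.im_displacement_pos hn h1' h2'
  set c := Complex.exp (-(Complex.I * φ)) * (γ ψ - γ φ) with hcd
  set c' := Complex.exp (-(Complex.I * φ)) * (γ ψ' - γ φ) with hcd'
  have hn1 : ‖γ ψ - γ φ‖ = ‖c‖ := by rw [hcd, norm_mul, norm_exp_neg_I_mul, one_mul]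
  have hn2 : ‖γ ψ' - γ φ‖ = ‖c'‖ := by rw [hcd', norm_mul, norm_exp_neg_I_mul, one_mul]
  rw [hn1, hn2] at h
  have hcne : c ≠ 0 := fun h0 => by rw [h0] at hc; simp at hc
  have hcne' : c' ≠ 0 := fun h0 => by rw [h0] at hc'; simp at hc'
  have hcos : Real.cos c.arg = Real.cos c'.arg := by
    rw [Complex.cos_arg hcne, Complex.cos_arg hcne', h]
  have harg0 : 0 < c.arg := by
    refine lt_of_le_of_ne (Complex.arg_nonneg_iff.2 hc.le) fun h0 => ?_
    exact hc.ne' (Complex.arg_eq_zero_iff.1 h0.symm).2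
  have hargpi : c.arg < Real.pi := by
    refine lt_of_le_of_ne (Complex.arg_le_pi c) fun h0 => ?_
    exact hc.ne' (Complex.arg_eq_pi_iff.1 h0).2
  have harg : c.arg = c'.arg := Real.injOn_cos ⟨harg0.le, Complex.arg_le_pi c⟩
    ⟨Complex.arg_nonneg_iff.2 hc'.le, Complex.arg_le_pi c'⟩ hcos
  -- The direction of the common chord line; `f` below is the signed height above that line.
  set η : ℝ := φ + c.arg with hη
  set f : ℝ → ℝ := fun t => (Complex.exp (-(Complex.I * η)) * (γ t - γ φ)).im with hf
  have hd : ∀ t, HasDerivAt f (‖deriv γ t‖ * Real.sin (t - η)) t :=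
    fun t => hγ.hasDerivAt_im_displacement η (γ φ) t
  have hcont : Continuous f := continuous_iff_continuousAt.2 fun t => (hd t).continuousAt
  have hzero : ∀ {t : ℝ} {w : ℂ}, w = Complex.exp (-(Complex.I * φ)) * (γ t - γ φ) →
      w.arg = c.arg → f t = 0 := by
    intro t w hw hwa
    have e1 : Complex.exp (-(Complex.I * η)) * (γ t - γ φ)
        = Complex.exp (-(Complex.I * (c.arg : ℝ))) * w := by
      rw [hw, ← mul_assoc, ← Complex.exp_add, hη]; congr 2; push_cast; ring
    have e2 : w = ‖w‖ * Complex.exp (Complex.I * (c.arg : ℝ)) := by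
      rw [← hwa, mul_comm Complex.I, Complex.norm_mul_exp_arg_mul_I]
    simp only [hf]
    rw [e1, e2, mul_left_comm, exp_neg_mul_exp_I, mul_one, Complex.ofReal_im]
  have z0 : f φ = 0 := by simp [hf]
  have z1 : f ψ = 0 := hzero hcd rfl
  have z2 : f ψ' = 0 := hzero hcd' harg.symm
  have z3 : f (φ + 2 * Real.pi) = 0 := by simp [hf, hγ.periodic hn]
  have hpi := Real.pi_pos
  -- the critical points of `f`
  have hcrit : ∀ {s u : ℝ}, s < u → f s = 0 → f u = 0 → φ ≤ s → u ≤ φ + 2 * Real.pi →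
      ∃ t ∈ Set.Ioo s u, t = η ∨ t = η + Real.pi := by
    intro s u hsu hs hu hs' hu'
    obtain ⟨t, ht, ht0⟩ := exists_hasDerivAt_eq_zero hsu hcont.continuousOn (hs.trans hu.symm)
      (fun t _ => hd t)
    refine ⟨t, ht, ?_⟩
    have hsin : Real.sin (t - η) = 0 := by
      rcases mul_eq_zero.1 ht0 with h0 | h0
      · exact absurd h0 (hγ.norm_deriv_pos t).ne'
      · exact h0
    obtain ⟨k, hk⟩ := Real.sin_eq_zero_iff.1 hsin
    have b1 : (-1 : ℝ) < k := by
      by_contra hlt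
      have : (k : ℝ) * Real.pi ≤ -1 * Real.pi := by
        apply mul_le_mul_of_nonneg_right (not_lt.1 hlt) hpi.le
      linarith [ht.1]
    have b2 : (k : ℝ) < 2 := by
      by_contra hlt
      have : 2 * Real.pi ≤ (k : ℝ) * Real.pi := by
        apply mul_le_mul_of_nonneg_right (not_lt.1 hlt) hpi.le
      linarith [ht.2]
    have b1' : -1 < k := by exact_mod_cast b1
    have b2' : k < 2 := by exact_mod_cast b2
    have : k = 0 ∨ k = 1 := by omega
    rcases this with rfl | rfl
    · left; push_cast at hk; linarith
    · right; push_cast at hk; linarith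
  -- Four zeros of `f` on one period would give, by Rolle, three critical points in disjoint
  -- intervals, but only `η` and `η + π` are available.
  have main : ∀ {s u : ℝ}, φ < s → s < u → u < φ + 2 * Real.pi → f s = 0 → f u = 0 → False := by
    intro s u hs hsu hu fs fu
    obtain ⟨t1, ⟨a1, b1⟩, c1⟩ := hcrit hs z0 fs le_rfl (by linarith)
    obtain ⟨t2, ⟨a2, b2⟩, c2⟩ := hcrit hsu fs fu hs.le (by linarith)
    obtain ⟨t3, ⟨a3, b3⟩, c3⟩ := hcrit hu fu z3 (by linarith) le_rfl
    rcases c1 with c1 | c1 <;> rcases c2 with c2 | c2 <;> rcases c3 with c3 | c3 <;> linarith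
  rcases lt_trichotomy ψ ψ' with hlt | heq | hgt
  · exact (main h1 hlt h2' z1 z2).elim
  · exact heq
  · exact (main h1' hgt h2 z2 z1).elim

theorem isBilliardStep_unique (hγ : IsSymmetricOval n γ) (hn : n ≠ 0) {x y y' : ℝ × ℝ}
    (h : IsBilliardStep γ x y) (h' : IsBilliardStep γ x y') : y = y' := by
  obtain ⟨-, φ, ψ, h1, h2, hx1, hx2, hy1, hy2⟩ := h
  obtain ⟨-, φ', ψ', h1', h2', hx1', hx2', hy1', hy2'⟩ := h'
  obtain rfl : φ = φ' := hγ.strictMono_arcLength.injective (hx1.symm.trans hx1')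
  obtain rfl : ψ = ψ' := hγ.eq_of_same_direction hn h1 h2 h1' h2' (hx2.symm.trans hx2')
  exact Prod.ext (hy1.trans hy1'.symm) (hy2.trans hy2'.symm)

/-- Uniqueness of the step makes the choice in `billiardMap` immaterial. -/
theorem billiardMap_eq (hγ : IsSymmetricOval n γ) (hn : n ≠ 0) {x y : ℝ × ℝ}
    (h : IsBilliardStep γ x y) : billiardMap γ x = y := by
  have hex : ∃ y, IsBilliardStep γ x y := ⟨y, h⟩
  rw [billiardMap, dif_pos hex]
  exact hγ.isBilliardStep_unique hn hex.choose_spec h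

end IsSymmetricOval

/-! ### The germ at a symmetric point. -/

namespace IsSymmetricOval

variable {n m : ℕ} {γ : ℝ → ℂ} {φ₀ : ℝ}

/-- The phase point carries a fixed point of the quotient map only if the oval is orthogonal there
to the position vector. -/
theorem position_of_fixedPoint (hγ : IsSymmetricOval n γ) (hm : 1 ≤ m) (hmn : m < n)
    (h : quotientMap γ n m (symmetricPoint γ n m φ₀) = symmetricPoint γ n m φ₀) :
    ∃ G : ℝ, 0 < G ∧ Complex.exp (-(Complex.I * φ₀)) * γ φ₀ = -Complex.I * G := by
  have hn : n ≠ 0 := by omega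
  have hn0 : (0 : ℝ) < n := by exact_mod_cast Nat.pos_of_ne_zero hn
  have hm0 : (0 : ℝ) < m := by exact_mod_cast hm
  have hmn' : (m : ℝ) < n := by exact_mod_cast hmn
  have hpi := Real.pi_pos
  set α : ℝ := m * Real.pi / n with hα
  have hα0 : 0 < α := by positivity
  have hα1 : α < Real.pi := by rw [hα, div_lt_iff₀ hn0]; nlinarith
  have hs : 0 < Real.sin α := Real.sin_pos_of_pos_of_lt_pi hα0 hα1
  set P := symmetricPoint γ n m φ₀ with hP
  -- If no step left `P`, the default value of `billiardMap` would be `P`, and the quotient map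
  -- would shift arc length by `-m/n` of the positive perimeter instead of fixing `P`.
  have hstep : IsBilliardStep γ P (billiardMap γ P) := by
    by_cases hex : ∃ y, IsBilliardStep γ P y
    · rw [billiardMap, dif_pos hex]; exact hex.choose_spec
    · exfalso
      have e : billiardMap γ P = P := by rw [billiardMap, dif_neg hex]
      have h1 := congrArg Prod.fst h
      rw [quotientMap, e] at h1
      have := hγ.arcLength_two_pi_pos
      have : 0 < (m / n : ℝ) * arcLength γ (2 * Real.pi) := by positivity
      simp only at h1
      linarith
  have hfst : (billiardMap γ P).1 = arcLength γ φ₀ + (m / n : ℝ) * arcLength γ (2 * Real.pi) := by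
    have := congrArg Prod.fst h
    simp only [quotientMap] at this
    have e : P.1 = arcLength γ φ₀ := rfl
    linarith
  have hsnd : (billiardMap γ P).2 = Real.cos α := congrArg Prod.snd h
  obtain ⟨-, φ, ψ, h1, h2, hx1, hx2, hy1, hy2⟩ := hstep
  obtain rfl : φ₀ = φ := hγ.strictMono_arcLength.injective hx1
  rw [hfst, ← hγ.arcLength_rotate hn] at hy1
  have hψ := hγ.strictMono_arcLength.injective hy1
  have h2α : (m : ℝ) * (2 * Real.pi / n) = 2 * α := by rw [hα]; ring
  rw [h2α] at hψ
  have hpos := hγ.im_displacement_pos hn h1 h2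
  have hx2' : Real.cos α = _ := hx2
  rw [hsnd, hγ.cos_angle_tangent] at hy2
  rw [hγ.cos_angle_tangent] at hx2'
  set η := Complex.exp (-(Complex.I * φ₀)) * γ φ₀ with hη
  have hγψ : γ ψ = Complex.exp (Complex.I * ((2 * α : ℝ) : ℂ)) * γ φ₀ := by
    have := hγ.rotate m φ₀
    rw [h2α] at this
    rw [← hψ, this]
  have e2s : Complex.exp (Complex.I * α) - Complex.exp (-(Complex.I * α))
      = 2 * Complex.I * (Real.sin α : ℝ) := by
    have := exp_I_mul_eq (-α)
    rw [show Complex.exp (-(Complex.I * α)) = Complex.exp (Complex.I * ((-α : ℝ) : ℂ)) by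
      congr 1; push_cast; ring, this, exp_I_mul_eq]
    apply Complex.ext
    · simp [-Complex.ofReal_sin]
    · simp [-Complex.ofReal_sin]; ring
  have e1 : Complex.exp (-(Complex.I * φ₀)) * (γ ψ - γ φ₀)
      = Complex.exp (Complex.I * α) * (2 * Complex.I * (Real.sin α : ℝ)) * η := by
    rw [← e2s, hγψ, hη]
    have : Complex.exp (Complex.I * ((2 * α : ℝ) : ℂ))
        = Complex.exp (Complex.I * α) * Complex.exp (Complex.I * α) := by
      rw [← Complex.exp_add]; congr 1; push_cast; ring
    rw [this]
    linear_combination (Complex.exp (-(Complex.I * φ₀)) * γ φ₀) * exp_neg_mul_exp_I (α : ℂ)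
  have e3 : Complex.exp (-(Complex.I * ψ)) * (γ ψ - γ φ₀)
      = Complex.exp (Complex.I * ((-α : ℝ) : ℂ)) * (2 * Complex.I * (Real.sin α : ℝ)) * η := by
    have a1 : Complex.exp (-(Complex.I * ψ)) * (γ ψ - γ φ₀)
        = Complex.exp (Complex.I * ((-(2 * α) : ℝ) : ℂ)) *
          (Complex.exp (-(Complex.I * φ₀)) * (γ ψ - γ φ₀)) := by
      rw [← mul_assoc, ← Complex.exp_add, ← hψ]; congr 2; push_cast; ring
    have a2 : Complex.exp (Complex.I * ((-(2 * α) : ℝ) : ℂ)) * Complex.exp (Complex.I * α)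
        = Complex.exp (Complex.I * ((-α : ℝ) : ℂ)) := by
      rw [← Complex.exp_add]; congr 1; push_cast; ring
    rw [a1, e1]
    linear_combination (2 * Complex.I * (Real.sin α : ℝ) * η) * a2
  have hne : γ ψ - γ φ₀ ≠ 0 := fun h0 => by
    rw [h0] at hpos; simp at hpos
  have hN : 0 < ‖γ ψ - γ φ₀‖ := norm_pos_iff.2 hne
  rw [e1] at hpos hx2'
  rw [e3] at hy2
  rw [exp_I_mul_eq] at hpos hx2' hy2
  rw [eq_div_iff hN.ne'] at hx2' hy2
  rw [hx2', Real.cos_neg, Real.sin_neg] at hy2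
  simp [-Complex.ofReal_sin, -Complex.ofReal_cos] at hy2 hpos
  -- The chord makes the same cosine with the tangents at its two ends; subtracting the two
  -- equations leaves `4 sin²α · Re η = 0`.
  have hre : η.re = 0 := by
    have : (4 * Real.sin α ^ 2) * η.re = 0 := by linear_combination -hy2
    rcases mul_eq_zero.1 this with h0 | h0
    · exact absurd h0 (by positivity)
    · exact h0
  refine ⟨-η.im, ?_, ?_⟩
  · rw [hre] at hpos
    have : 0 < Real.sin α ^ 2 := by positivity
    nlinarith
  · apply Complex.ext
    · simp [hre]
    · simp

/-- The germ of the oval at a point where it is orthogonal to the position vector. -/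
theorem isNormalizedGerm (hγ : IsSymmetricOval n γ) {G : ℝ} (hG : 0 < G)
    (h : Complex.exp (-(Complex.I * φ₀)) * γ φ₀ = -Complex.I * G) :
    IsNormalizedGerm
      (fun x => (‖deriv γ φ₀‖ : ℂ)⁻¹ * (Complex.exp (-(Complex.I * φ₀)) * γ (φ₀ + x)))
      (fun x => ‖deriv γ φ₀‖⁻¹ * ‖deriv γ (φ₀ + x)‖) (G / ‖deriv γ φ₀‖) := by
  have hr := hγ.norm_deriv_pos φ₀
  refine ⟨?_, fun x => ?_, ?_, ?_, by positivity⟩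
  · exact contDiff_const.mul (hγ.contDiff_norm_deriv.comp (contDiff_const.add contDiff_id))
  · have h1 := (((hγ.hasDerivAt (φ₀ + x)).comp_const_add φ₀ x).const_mul
      (Complex.exp (-(Complex.I * φ₀)))).const_mul (‖deriv γ φ₀‖ : ℂ)⁻¹
    refine h1.congr_deriv ?_
    have : Complex.exp (-(Complex.I * φ₀)) * Complex.exp (Complex.I * ((φ₀ + x : ℝ) : ℂ))
        = Complex.exp (Complex.I * x) := by
      rw [← Complex.exp_add]; congr 1; push_cast; ring
    rw [mul_left_comm (Complex.exp _), this]
    push_cast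
    ring
  · simp [hr.ne']
  · simp only [add_zero]
    rw [h]; push_cast; field_simp

/-- Near a symmetric fixed point the quotient map is the billiard map of the germ. -/
theorem eventually_quotientMap_eq (hγ : IsSymmetricOval n γ) (hm : 1 ≤ m) (hmn : m < n) {G : ℝ}
    (hG : 0 < G) (h : Complex.exp (-(Complex.I * φ₀)) * γ φ₀ = -Complex.I * G) :
    ∀ᶠ v : ℝ × ℝ in 𝓝 0, quotientMap γ n m (arcLength γ (φ₀ + v.1),
        outMomentum (m * Real.pi / n) (fun x => (‖deriv γ φ₀‖ : ℂ)⁻¹ *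
          (Complex.exp (-(Complex.I * φ₀)) * γ (φ₀ + x))) v.1 v.2)
      = (arcLength γ (φ₀ + v.2), inMomentum (m * Real.pi / n) (fun x => (‖deriv γ φ₀‖ : ℂ)⁻¹ *
          (Complex.exp (-(Complex.I * φ₀)) * γ (φ₀ + x))) v.1 v.2) := by
  have hn : n ≠ 0 := by omega
  have hn0 : (0 : ℝ) < n := by exact_mod_cast Nat.pos_of_ne_zero hn
  have hm0 : (0 : ℝ) < m := by exact_mod_cast hm
  have hmn' : (m : ℝ) < n := by exact_mod_cast hmn
  have hpi := Real.pi_pos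
  have hr := hγ.norm_deriv_pos φ₀
  have hN := hγ.isNormalizedGerm hG h
  set N : ℝ → ℂ := fun x => (‖deriv γ φ₀‖ : ℂ)⁻¹ *
    (Complex.exp (-(Complex.I * φ₀)) * γ (φ₀ + x)) with hNdef
  set α : ℝ := m * Real.pi / n with hα
  have hα0 : 0 < α := by positivity
  have hα1 : α < Real.pi := by rw [hα, div_lt_iff₀ hn0]; nlinarith
  have hs : 0 < Real.sin α := Real.sin_pos_of_pos_of_lt_pi hα0 hα1
  have h2α : (m : ℝ) * (2 * Real.pi / n) = 2 * α := by rw [hα]; ring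
  have hout : ∀ᶠ v : ℝ × ℝ in 𝓝 0, outMomentum α N v.1 v.2 ∈ Set.Ioo (-1 : ℝ) 1 := by
    have hc : ContinuousAt (fun v : ℝ × ℝ => outMomentum α N v.1 v.2) 0 :=
      (hN.contDiffAt_outMomentum contDiffAt_fst contDiffAt_snd
        (hN.eventually_germChord hs).self_of_nhds.1).continuousAt
    refine hc.eventually (isOpen_Ioo.mem_nhds ?_)
    simp only [Prod.fst_zero, Prod.snd_zero]
    rw [hN.outMomentum_zero hs]
    have hsq := Real.sin_sq_add_cos_sq α
    have : 0 < Real.sin α ^ 2 := by positivity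
    constructor <;> nlinarith
  have hlt : ∀ᶠ v : ℝ × ℝ in 𝓝 0, φ₀ + v.1 < φ₀ + v.2 + 2 * α ∧
      φ₀ + v.2 + 2 * α < φ₀ + v.1 + 2 * Real.pi := by
    have hc : Filter.Tendsto (fun v : ℝ × ℝ => v.2 - v.1) (𝓝 0) (𝓝 0) := by
      have : Continuous (fun v : ℝ × ℝ => v.2 - v.1) := by fun_prop
      simpa using this.tendsto 0
    filter_upwards [hc.eventually (lt_mem_nhds (show -(2 * α) < 0 by linarith)),
      hc.eventually (gt_mem_nhds (show 0 < 2 * Real.pi - 2 * α by linarith))] with v h1 h2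
    constructor <;> linarith
  filter_upwards [hout, hlt, hN.eventually_germChord hs] with v hv1 hv2 hv3
  set x := v.1
  set y := v.2
  have hγy : γ (φ₀ + y + 2 * α) = Complex.exp (Complex.I * ((2 * α : ℝ) : ℂ)) * γ (φ₀ + y) := by
    have := hγ.rotate m (φ₀ + y)
    rwa [h2α] at this
  -- Arrival is at tangent angle `φ₀ + y + 2α`, the copy of `φ₀ + y` under `m` rotations. In the
  -- symmetric frame turned by `φ₀ + α`, the chord is the germ chord times the radius of curvature.
  have hchord : γ (φ₀ + y + 2 * α) - γ (φ₀ + x)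
      = Complex.exp (Complex.I * ((φ₀ + α : ℝ) : ℂ)) * ((‖deriv γ φ₀‖ : ℂ) *
        germChord α N x y) := by
    have hr' : (‖deriv γ φ₀‖ : ℂ) ≠ 0 := by exact_mod_cast hr.ne'
    have a1 : Complex.exp (Complex.I * ((φ₀ + α : ℝ) : ℂ)) * (Complex.exp (Complex.I * α) *
        Complex.exp (-(Complex.I * φ₀))) = Complex.exp (Complex.I * ((2 * α : ℝ) : ℂ)) := by
      rw [← Complex.exp_add, ← Complex.exp_add]; congr 1; push_cast; ring
    have a2 : Complex.exp (Complex.I * ((φ₀ + α : ℝ) : ℂ)) *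
        (Complex.exp (Complex.I * ((-α : ℝ) : ℂ)) * Complex.exp (-(Complex.I * φ₀))) = 1 := by
      rw [← Complex.exp_add, ← Complex.exp_add, ← Complex.exp_zero]; congr 1; push_cast; ring
    have a3 : (‖deriv γ φ₀‖ : ℂ) * germChord α N x y
        = Complex.exp (Complex.I * α) * (Complex.exp (-(Complex.I * φ₀)) * γ (φ₀ + y))
        - Complex.exp (Complex.I * ((-α : ℝ) : ℂ)) *
          (Complex.exp (-(Complex.I * φ₀)) * γ (φ₀ + x)) := by
      rw [germChord]; simp only [hNdef]; field_simp
    rw [hγy, a3]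
    linear_combination (-γ (φ₀ + y)) * a1 + (γ (φ₀ + x)) * a2
  set c := germChord α N x y with hc
  have hc0 : 0 < ‖c‖ := (mul_pos hN.pos hs).trans hv3.2
  have hmom : ∀ ψ : ℝ, Real.cos (InnerProductGeometry.angle (deriv γ ψ)
      (γ (φ₀ + y + 2 * α) - γ (φ₀ + x))) = Real.cos (φ₀ + α - ψ + c.arg) := by
    intro ψ
    rw [hγ.cos_angle_tangent, hchord, norm_mul, norm_exp_I_mul, one_mul, norm_mul,
      Complex.norm_real, Real.norm_eq_abs, abs_of_pos hr]
    have a1 : Complex.exp (-(Complex.I * ψ)) * (Complex.exp (Complex.I * ((φ₀ + α : ℝ) : ℂ)) *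
        ((‖deriv γ φ₀‖ : ℂ) * c)) = ((‖deriv γ φ₀‖ * ‖c‖ : ℝ) : ℂ) *
        Complex.exp (Complex.I * ((φ₀ + α - ψ + c.arg : ℝ) : ℂ)) := by
      conv_lhs => rw [← Complex.norm_mul_exp_arg_mul_I c]
      have : Complex.exp (Complex.I * ((φ₀ + α - ψ + c.arg : ℝ) : ℂ))
          = Complex.exp (-(Complex.I * ψ)) * Complex.exp (Complex.I * ((φ₀ + α : ℝ) : ℂ)) *
            Complex.exp (c.arg * Complex.I) := by
        rw [← Complex.exp_add, ← Complex.exp_add]; congr 1; push_cast; ring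
      rw [this]; push_cast; ring
    rw [a1, Complex.re_ofReal_mul, exp_I_mul_eq, mul_div_cancel_left₀ _ (by positivity)]
  have hstep : IsBilliardStep γ (arcLength γ (φ₀ + x), outMomentum α N x y)
      (arcLength γ (φ₀ + y + 2 * α), inMomentum α N x y) := by
    refine ⟨hv1, φ₀ + x, φ₀ + y + 2 * α, hv2.1, hv2.2, rfl, ?_, rfl, ?_⟩
    · rw [hmom, outMomentum, Complex.log_im, ← hc]; ring_nf
    · rw [hmom, inMomentum, Complex.log_im, ← hc]; ring_nf
  rw [quotientMap, hγ.billiardMap_eq hn hstep, ← h2α, hγ.arcLength_rotate hn]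
  simp

theorem hasDerivAt_supportFunction (hγ : IsSymmetricOval n γ) (φ : ℝ) :
    HasDerivAt (supportFunction γ) (inner ℝ (γ φ) (Complex.exp (Complex.I * φ))) φ := by
  have hE : HasDerivAt (fun φ : ℝ => Complex.exp (Complex.I * φ))
      (Complex.exp (Complex.I * φ) * Complex.I) φ := by
    have := ((Complex.ofRealCLM.hasDerivAt (x := φ)).const_mul Complex.I).cexp
    simpa using this
  have h := (hγ.hasDerivAt φ).inner ℝ (hE.const_mul (-Complex.I))
  refine h.congr_deriv ?_
  have e : -Complex.I * (Complex.exp (Complex.I * φ) * Complex.I) = Complex.exp (Complex.I * φ) := by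
    linear_combination (-Complex.exp (Complex.I * φ)) * Complex.I_sq
  rw [e, exp_I_mul_eq, Complex.inner, Complex.inner]
  simp [-Complex.ofReal_sin, -Complex.ofReal_cos]
  ring

/-- The radius of curvature is the support function plus its second derivative; this translates
non-resonance into conditions on `cos θ`. -/
theorem iteratedDeriv_two_supportFunction (hγ : IsSymmetricOval n γ) (φ : ℝ) :
    iteratedDeriv 2 (supportFunction γ) φ = ‖deriv γ φ‖ - supportFunction γ φ := by
  rw [iteratedDeriv_succ, iteratedDeriv_one, show deriv (supportFunction γ) = fun φ =>
    inner ℝ (γ φ) (Complex.exp (Complex.I * φ)) from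
    funext fun φ => (hγ.hasDerivAt_supportFunction φ).deriv]
  have hE : HasDerivAt (fun φ : ℝ => Complex.exp (Complex.I * φ))
      (Complex.exp (Complex.I * φ) * Complex.I) φ := by
    have := ((Complex.ofRealCLM.hasDerivAt (x := φ)).const_mul Complex.I).cexp
    simpa using this
  have h := (hγ.hasDerivAt φ).inner ℝ hE
  rw [h.deriv, supportFunction, exp_I_mul_eq, Complex.inner, Complex.inner, Complex.inner]
  have := Real.sin_sq_add_cos_sq φ
  simp [-Complex.ofReal_sin, -Complex.ofReal_cos]
  linear_combination ‖deriv γ φ‖ * this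

theorem supportFunction_eq {G : ℝ}
    (h : Complex.exp (-(Complex.I * φ₀)) * γ φ₀ = -Complex.I * G) :
    supportFunction γ φ₀ = G := by
  have e : γ φ₀ = Complex.exp (Complex.I * φ₀) * (-Complex.I * G) := by
    rw [← h, ← mul_assoc, ← Complex.exp_add]; simp
  rw [supportFunction, e, exp_I_mul_eq, Complex.inner]
  have := Real.sin_sq_add_cos_sq φ₀
  simp [-Complex.ofReal_sin, -Complex.ofReal_cos]
  linear_combination G * this

end IsSymmetricOval

/-! ### Conclusion. -/

/-- On `(0, π/2]` the cosine is nonnegative, so `cot²` determines it. This is what restricts the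
conclusion to `m ≤ n/2`: the angles `α` and `π - α` have the same `cot²`. -/
theorem eq_of_cot_sq_eq {α β : ℝ} (hα : 0 < α) (hα' : α ≤ Real.pi / 2) (hβ : 0 < β)
    (hβ' : β ≤ Real.pi / 2)
    (h : (Real.cos α / Real.sin α) ^ 2 = (Real.cos β / Real.sin β) ^ 2) : α = β := by
  have hpi := Real.pi_pos
  have sα : 0 < Real.sin α := Real.sin_pos_of_pos_of_lt_pi hα (by linarith)
  have sβ : 0 < Real.sin β := Real.sin_pos_of_pos_of_lt_pi hβ (by linarith)
  have cα : 0 ≤ Real.cos α := Real.cos_nonneg_of_mem_Icc ⟨by linarith, hα'⟩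
  have cβ : 0 ≤ Real.cos β := Real.cos_nonneg_of_mem_Icc ⟨by linarith, hβ'⟩
  have h1 : Real.cos α ^ 2 = Real.cos β ^ 2 := by
    rw [div_pow, div_pow, div_eq_div_iff (by positivity) (by positivity), Real.sin_sq,
      Real.sin_sq] at h
    linarith
  have h2 : Real.cos α = Real.cos β := by
    rwa [sq_eq_sq₀ cα cβ] at h1
  exact Real.injOn_cos ⟨hα.le, by linarith⟩ ⟨hβ.le, by linarith⟩ h2

theorem mainTheorem3 (n : ℕ) (hn : 2 ≤ n) (γ : ℝ → ℂ) (hγ : IsSymmetricOval n γ)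
    (φ₀ : ℝ) (hell : IsEllipticSymmetricFamily γ n φ₀) (hres : IsNonResonantFamily γ φ₀) :
    (∀ m : ℕ, 1 ≤ m → 2 * m ≤ n →
      ∃! τ : ℝ, IsTwistCoefficient (quotientMap γ n m) (symmetricPoint γ n m φ₀) τ) ∧
    {m : ℕ | 1 ≤ m ∧ 2 * m ≤ n ∧
      IsTwistCoefficient (quotientMap γ n m) (symmetricPoint γ n m φ₀) 0}.Subsingleton := by
  have hn0 : (0 : ℝ) < n := by exact_mod_cast (by omega : 0 < n)
  have hpi := Real.pi_pos
  -- The germ depends only on `φ₀`, so `m = 1` is enough to find it and to bound its base height; `n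
  -- ≥ 2` makes that value admissible.
  obtain ⟨G, hG, hbase⟩ := hγ.position_of_fixedPoint le_rfl (by omega) (hell 1 le_rfl (by omega)).1
  have hr := hγ.norm_deriv_pos φ₀
  have hN := hγ.isNormalizedGerm hG hbase
  have hS' : HasDerivAt (fun x => arcLength γ (φ₀ + x)) ‖deriv γ φ₀‖ 0 := by
    have := (hγ.hasDerivAt_arcLength (φ₀ + 0)).comp_const_add φ₀ 0
    simpa using this
  have hS : ContDiff ℝ ∞ (fun x => arcLength γ (φ₀ + x)) :=
    hγ.contDiff_arcLength.comp (contDiff_const.add contDiff_id)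
  have hsin : ∀ m : ℕ, 1 ≤ m → m < n → 0 < Real.sin (m * Real.pi / n) := by
    intro m hm hmn
    have hm0 : (0 : ℝ) < m := by exact_mod_cast hm
    have hmn' : (m : ℝ) < n := by exact_mod_cast hmn
    refine Real.sin_pos_of_pos_of_lt_pi (by positivity) ?_
    rw [div_lt_iff₀ hn0]; nlinarith
  have hP : ∀ m : ℕ, symmetricPoint γ n m φ₀
      = (arcLength γ (φ₀ + 0), Real.cos (m * Real.pi / n)) := by
    intro m; rw [add_zero]; rfl
  set g : ℝ := G / ‖deriv γ φ₀‖ with hg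
  have hg1 : g < 1 := hN.lt_one_of_elliptic (hsin 1 le_rfl (by omega)) hr hS' (hP 1)
    (hγ.eventually_quotientMap_eq le_rfl (by omega) hG hbase) (hell 1 le_rfl (by omega))
  have hg0 : 0 < g := hN.pos
  -- Half of the trace `4g - 2` is `cos θ`.
  set θ : ℝ := Real.arccos (2 * g - 1) with hθdef
  have hcos : Real.cos θ = 2 * g - 1 := Real.cos_arccos (by linarith) (by linarith)
  have hθ : 0 < Real.sin θ := by
    rw [hθdef, Real.sin_arccos]
    exact Real.sqrt_pos.2 (by nlinarith)
  have hgθ : g = (1 + Real.cos θ) / 2 := by rw [hcos]; ring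
  have hGg : G = g * ‖deriv γ φ₀‖ := by rw [hg]; field_simp
  obtain ⟨hres1, hres2⟩ := hres
  rw [hγ.iteratedDeriv_two_supportFunction,
    IsSymmetricOval.supportFunction_eq hbase] at hres1 hres2
  -- In terms of the radius of curvature `r`, the two non-resonance expressions are `r cos θ` and
  -- `r(2 cos θ + 1)`.
  have hκ : Real.cos θ ≠ 0 := by
    intro h0
    apply hres1
    rw [hcos] at h0
    rw [hGg]; linear_combination ‖deriv γ φ₀‖ * h0
  have hκ' : 2 * Real.cos θ + 1 ≠ 0 := by
    intro h0
    apply hres2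
    rw [hcos] at h0
    rw [hGg]; linear_combination ‖deriv γ φ₀‖ * h0
  rw [hgθ] at hN
  set ρ : ℝ → ℝ := fun x => ‖deriv γ φ₀‖⁻¹ * ‖deriv γ (φ₀ + x)‖
  -- `A` and `B` depend only on `θ` and the 2-jet of the curvature radius, so they are fixed before
  -- `m` is.
  obtain ⟨A, B, hB, hAB⟩ := exists_orbitCoefficients hθ.ne' (by rw [hcos]; linarith)
    (by rw [hcos]; linarith) hκ hκ' (deriv ρ 0) (deriv (deriv ρ) 0)
  have key : ∀ m : ℕ, 1 ≤ m → m < n → ∃ μ : ℝ, 0 < μ ∧ ∀ τ : ℝ,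
      IsTwistCoefficient (quotientMap γ n m) (symmetricPoint γ n m φ₀) τ ↔
        τ = (A + B * (Real.cos (m * Real.pi / n) / Real.sin (m * Real.pi / n)) ^ 2) * μ := by
    intro m hm hmn
    obtain ⟨q, h, p, c, e, hc⟩ := hAB (Real.cos (m * Real.pi / n) / Real.sin (m * Real.pi / n))
    exact hN.isTwistCoefficient_iff (hsin m hm hmn) hθ hS hr hS' (hP m) (hell m hm hmn).1
      (hγ.eventually_quotientMap_eq hm hmn hG hbase) hc
  refine ⟨fun m hm hmn => ?_, ?_⟩
  · obtain ⟨μ, -, hμ⟩ := key m hm (by omega)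
    exact ⟨_, (hμ _).2 rfl, fun τ hτ => (hμ τ).1 hτ⟩
  · rintro m ⟨hm, hmn, hτ⟩ m' ⟨hm', hmn', hτ'⟩
    have hzero : ∀ m : ℕ, 1 ≤ m → 2 * m ≤ n →
        IsTwistCoefficient (quotientMap γ n m) (symmetricPoint γ n m φ₀) 0 →
        A + B * (Real.cos (m * Real.pi / n) / Real.sin (m * Real.pi / n)) ^ 2 = 0 := by
      intro m hm hmn hτ
      obtain ⟨μ, hμ0, hμ⟩ := key m hm (by omega)
      rcases mul_eq_zero.1 ((hμ 0).1 hτ).symm with h0 | h0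
      · exact h0
      · exact absurd h0 hμ0.ne'
    have hang : ∀ m : ℕ, 1 ≤ m → 2 * m ≤ n → 0 < m * Real.pi / n ∧
        m * Real.pi / n ≤ Real.pi / 2 := by
      intro m hm hmn
      have hm0 : (0 : ℝ) < m := by exact_mod_cast hm
      have hmn' : (2 : ℝ) * m ≤ n := by exact_mod_cast hmn
      refine ⟨by positivity, ?_⟩
      rw [div_le_div_iff₀ hn0 two_pos]
      nlinarith
    have h1 := hzero m hm hmn hτ
    have h2 := hzero m' hm' hmn' hτ'
    have h4 := eq_of_cot_sq_eq (hang m hm hmn).1 (hang m hm hmn).2 (hang m' hm' hmn').1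
      (hang m' hm' hmn').2
      (mul_left_cancel₀ hB (by linarith))
    have h5 : (m : ℝ) = m' := by
      have : (m : ℝ) * Real.pi = m' * Real.pi := by
        field_simp at h4; simpa using h4
      exact mul_right_cancel₀ hpi.ne' this
    exact_mod_cast h5
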